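/- We work with compactly generated topologies: products are taken in the category of compactly generated spaces (the k-ification of the product topology). For a space $X$ with base point $x_0$ let $X^n$ be the $n$-fold Cartesian power, and for $k\ge 1$ let $X^{(k)}$ be the $k$-fold smash power, i.e. the quotient of $X^k$ that collapses the points with some coordinate equal to $x_0$ to one point; write $x_1\wedge\dots\wedge x_k$ for the image of $(x_1,\dots,x_k)$. For a pointed space $(Y,y_0)$ let $J(Y)$ be the James construction: the monoid of words in the points of $Y$ subject to the single relation $y_0=1$, with the quotient topology from $\bigsqcup_{m\ge 0}Y^m$; let $E\colon Y\to J(Y)$ be the canonical inclusion. The set $[X^n,J(X^{(k)})]$ of pointed homotopy classes of pointed maps is a monoid under pointwise multiplication of representatives. For integers $n\ge 0$, $k\ge 1$ let $K_n(k)$ be the group generated by the words $\{x_{i_1}|\cdots|x_{i_k}\}$ with $1\le i_1,\dots,i_k\le n$, subject to the following relations, in which $[x,y]=x^{-1}y^{-1}xy$ and $[[a_1,\dots,a_l]=[\cdots[[a_1,a_2],a_3],\cdots,a_l]$ (equal to $a_1$ if $l=1$): 1. $\{x_{i_1}|\cdots|x_{i_k}\}=1$ if $i_s=i_t$ for some $s<t$;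 2. $[[\{x_{i_1}|\cdots|x_{i_k}\},\{x_{i_{k+1}}|\cdots|x_{i_{2k}}\},\dots,\{x_{i_{(l-1)k+1}}|\cdots|x_{i_{lk}}\}]=1$ if $i_s=i_t$ for some $1\le s<t\le kl$; 3. $[[w_1^{n_1},\dots,w_l^{n_l}]=[[w_1,\dots,w_l]^{n_1\cdots n_l}$ for all generators $w_1,\dots,w_l$ and all integers $n_1,\dots,n_l$. **Proposition.** Let $X$ be a compactly generated path connected space with a non-degenerate base point $x_0$ (that is, $(X,\{x_0\})$ is an NDR pair), and suppose that $X$ has weak LS-category less than $2$, i.e. the reduced diagonal $X\to X^{(2)}$, $x\mapsto x\wedge x$, is pointed null homotopic. Let $n\ge 0$ and $k\ge 1$. (a) If $X$ has the homotopy type of a CW complex, then the monoid $[X^n,J(X^{(k)})]$ is a group. (b) Whenever $[X^n,J(X^{(k)})]$ is a group, there is a group homomorphism $$e_X\colon K_n(k)\longrightarrow [X^n,J(X^{(k)})]$$ that sends each generator $\{x_{i_1}|\cdots|x_{i_k}\}$ to the homotopy class of the composite $$X^n\xrightarrow{\;p_{i_1\cdots i_k}\;}X^{(k)}\xrightarrow{\;E\;}J(X^{(k)}),\qquad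 p_{i_1\cdots i_k}(x_1,\dots,x_n)=x_{i_1}\wedge\cdots\wedge x_{i_k}.$$ -/

import Mathlib

open Topology
open scoped unitInterval

universe u

namespace CohenJames

/-! ### Compactly generated products, smash powers, the James construction -/

/-- The family of all compact Hausdorff spaces (in the universe `u`). -/
abbrev compHausFamily : CompHaus.{u} → Type u := fun S => S

/-- `KSpace Z` is the set `Z` with the compactly generated topology associated with the given one
(the k-ification of `Z`): the finest topology for which every map from a compact Hausdorff space
that is continuous for the given topology stays continuous. -/
abbrev KSpace (Z : Type u) [TopologicalSpace Z] : Type u :=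
  WithGeneratedByTopology compHausFamily.{u} Z

/-- The `n`-fold Cartesian power of `X` in the category of compactly generated spaces. -/
abbrev KPow (X : Type u) [TopologicalSpace X] (n : ℕ) : Type u :=
  KSpace (Fin n → X)

/-- The point of the Cartesian power with the given coordinates. -/
def KPow.mk {X : Type u} [TopologicalSpace X] {n : ℕ} (v : Fin n → X) : KPow X n :=
  WithGeneratedByTopology.equiv.symm v

/-- The coordinates of a point of the Cartesian power. -/
def KPow.coord {X : Type u} [TopologicalSpace X] {n : ℕ} (v : KPow X n) : Fin n → X :=
  WithGeneratedByTopology.equiv v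

/-- The equivalence relation on `X^k` that collapses the fat wedge (the points with at least one
coordinate equal to the base point) to a point. -/
def smashSetoid {X : Type u} [TopologicalSpace X] (x₀ : X) (k : ℕ) : Setoid (KPow X k) where
  r v w := v = w ∨ ((∃ i, v.coord i = x₀) ∧ ∃ i, w.coord i = x₀)
  iseqv :=
    { refl := fun _ => Or.inl rfl
      symm := by
        rintro v w (h | ⟨h, h'⟩)
        · exact Or.inl h.symm
        · exact Or.inr ⟨h', h⟩
      trans := by
        rintro a b c (rfl | ⟨h, h'⟩) (rfl | ⟨h₁, h₂⟩)
        · exact Or.inl rfl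
        · exact Or.inr ⟨h₁, h₂⟩
        · exact Or.inr ⟨h, h'⟩
        · exact Or.inr ⟨h, h₂⟩ }

/-- The `k`-fold smash power `X^(k)` (for `k ≥ 1`) of the pointed space `(X, x₀)`, with the quotient
topology from the compactly generated power `X^k`. -/
abbrev Smash {X : Type u} [TopologicalSpace X] (x₀ : X) (k : ℕ) : Type u :=
  Quotient (smashSetoid x₀ k)

/-- The point `x_1 ∧ ... ∧ x_k` of the smash power. -/
def Smash.mk {X : Type u} [TopologicalSpace X] (x₀ : X) {k : ℕ} (v : Fin k → X) : Smash x₀ k :=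
  Quotient.mk (smashSetoid x₀ k) (KPow.mk v)

/-- The base point of the smash power. -/
def Smash.base {X : Type u} [TopologicalSpace X] (x₀ : X) (k : ℕ) : Smash x₀ k :=
  Smash.mk x₀ fun _ => x₀

/-- The congruence on the free monoid on `Y` generated by `y₀ = 1`. -/
def jamesCon {Y : Type u} (y₀ : Y) : Con (FreeMonoid Y) :=
  conGen fun a b => a = FreeMonoid.of y₀ ∧ b = 1

/-- The James construction `J(Y)` on the pointed space `(Y, y₀)`: words in the points of `Y`, where
occurrences of the letter `y₀` may be deleted or inserted. -/
def James {Y : Type u} (y₀ : Y) : Type u :=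
  (jamesCon y₀).Quotient

instance {Y : Type u} (y₀ : Y) : Monoid (James y₀) :=
  inferInstanceAs (Monoid (jamesCon y₀).Quotient)

/-- The word `y_1 ... y_m` as a point of `J(Y)`. -/
def James.word {Y : Type u} (y₀ : Y) (l : List Y) : James y₀ :=
  (jamesCon y₀).toQuotient (FreeMonoid.ofList l)

/-- The projection from the disjoint union of the powers `Y^m` onto `J(Y)`. -/
def James.proj {Y : Type u} [TopologicalSpace Y] (y₀ : Y) (s : Σ m : ℕ, KPow Y m) : James y₀ :=
  James.word y₀ (List.ofFn s.2.coord)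

/-- `J(Y)` has the quotient topology from the disjoint union of the compactly generated
powers `Y^m`. -/
instance {Y : Type u} [TopologicalSpace Y] (y₀ : Y) : TopologicalSpace (James y₀) :=
  TopologicalSpace.coinduced (James.proj y₀) inferInstance

/-! ### Continuity facts -/

instance isGeneratedBy_of_compactlyGenerated (X : Type u) [TopologicalSpace X]
    [CompactlyGeneratedSpace X] : IsGeneratedBy compHausFamily.{u} X where
  continuous_equiv_symm := by
    refine continuous_from_uCompactlyGeneratedSpace _ fun S g => ?_
    exact (IsGeneratedBy.equiv_symm_comp_continuous_iff (X := compHausFamily.{u}) (g : S → X)).2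
      g.continuous

theorem KPow.continuous_coord {X : Type u} [TopologicalSpace X] {n : ℕ} :
    Continuous (KPow.coord : KPow X n → Fin n → X) :=
  WithGeneratedByTopology.continuous_equiv

theorem KPow.continuous_mk {W X : Type u} [TopologicalSpace W] [TopologicalSpace X]
    [IsGeneratedBy compHausFamily.{u} W] {n : ℕ} {f : W → Fin n → X} (hf : Continuous f) :
    Continuous fun w => KPow.mk (f w) :=
  (IsGeneratedBy.equiv_symm_comp_continuous_iff (X := compHausFamily.{u}) f).2 hf

theorem Smash.continuous_mk {W X : Type u} [TopologicalSpace W] [TopologicalSpace X]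
    [IsGeneratedBy compHausFamily.{u} W] (x₀ : X) {k : ℕ} {f : W → Fin k → X}
    (hf : Continuous f) : Continuous fun w => Smash.mk x₀ (f w) :=
  continuous_quotient_mk'.comp (KPow.continuous_mk hf)

theorem Smash.mk_eq_base {X : Type u} [TopologicalSpace X] (x₀ : X) {k : ℕ} (v : Fin k → X)
    (h : ∃ i, v i = x₀) : Smash.mk x₀ v = Smash.base x₀ k :=
  Quotient.sound (Or.inr ⟨h, h.imp fun _ _ => rfl⟩)

theorem James.continuous_proj {Y : Type u} [TopologicalSpace Y] (y₀ : Y) :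
    Continuous (James.proj y₀) :=
  continuous_coinduced_rng

theorem James.isQuotientMap_proj {Y : Type u} [TopologicalSpace Y] (y₀ : Y) :
    IsQuotientMap (James.proj y₀) where
  surjective a := by
    obtain ⟨l, rfl⟩ := Quotient.exists_rep a
    exact ⟨⟨l.toList.length, KPow.mk l.toList.get⟩, by
      show James.word y₀ (List.ofFn l.toList.get) = _
      rw [List.ofFn_get]; rfl⟩
  eq_coinduced := rfl

theorem James.word_append {Y : Type u} (y₀ : Y) (l l' : List Y) :
    James.word y₀ (l ++ l') = James.word y₀ l * James.word y₀ l' :=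
  rfl

theorem James.word_base {Y : Type u} (y₀ : Y) : James.word y₀ [y₀] = 1 :=
  (Con.eq _).2 (ConGen.Rel.of _ _ ⟨rfl, rfl⟩)

/-- A map on `Z × K`, with `Z` compactly generated and `K` locally compact, is continuous as soon as
it is continuous after composition with every test map into `Z`. -/
theorem continuous_prod_of_test {Z : Type u} {K T : Type*} [TopologicalSpace Z]
    [TopologicalSpace K] [TopologicalSpace T] [IsGeneratedBy compHausFamily.{u} Z]
    [LocallyCompactSpace K] (F : Z × K → T)
    (h : ∀ (L : CompHaus.{u}) (a : C(L, Z)), Continuous fun p : L × K => F (a p.1, p.2)) :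
    Continuous F := by
  have h₁ : ∀ z, Continuous fun x => F (z, x) := fun z =>
    (h (CompHaus.of PUnit) (ContinuousMap.const _ z)).comp
      (Continuous.prodMk (continuous_const (y := PUnit.unit)) continuous_id)
  let G : Z → C(K, T) := fun z => ⟨fun x => F (z, x), h₁ z⟩
  have hG : Continuous G := by
    rw [IsGeneratedBy.continuous_iff compHausFamily.{u}]
    intro L a
    exact ContinuousMap.continuous_of_continuous_uncurry _ (h L a)
  exact ContinuousMap.continuous_uncurry_of_continuous ⟨G, hG⟩

/-- A monoid whose multiplication is continuous for the compactly generated product topology. -/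
class ContinuousKMul (M : Type u) [TopologicalSpace M] [Monoid M] : Prop where
  continuous_mul_test : ∀ (K : Type u) [TopologicalSpace K] [CompactSpace K] [T2Space K]
    (f g : K → M), Continuous f → Continuous g → Continuous fun x => f x * g x

theorem James.continuous_mul_aux {Y : Type u} [TopologicalSpace Y] (y₀ : Y) {L L' : Type u}
    [TopologicalSpace L] [CompactSpace L] [T2Space L]
    [TopologicalSpace L'] [CompactSpace L'] [T2Space L'] (m m' : ℕ) (a : L → KPow Y m)
    (b : L' → KPow Y m') (ha : Continuous a) (hb : Continuous b) :
    Continuous fun p : L × L' => James.proj y₀ ⟨m, a p.1⟩ * James.proj y₀ ⟨m', b p.2⟩ := by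
  have key : (fun p : L × L' => James.proj y₀ ⟨m, a p.1⟩ * James.proj y₀ ⟨m', b p.2⟩) =
      fun p : L × L' => James.proj y₀
        ⟨m + m', KPow.mk (Fin.append (a p.1).coord (b p.2).coord)⟩ := by
    funext p
    show James.word y₀ _ * James.word y₀ _ =
      James.word y₀ (List.ofFn (Fin.append (a p.1).coord (b p.2).coord))
    rw [List.ofFn_fin_append, James.word_append]
  rw [key]
  refine (James.continuous_proj y₀).comp (continuous_sigmaMk.comp (KPow.continuous_mk ?_))
  refine continuous_pi fun i => ?_
  refine Fin.addCases (fun j => ?_) (fun j => ?_) i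
  · simp only [Fin.append_left]
    exact (continuous_apply j).comp (KPow.continuous_coord.comp (ha.comp continuous_fst))
  · simp only [Fin.append_right]
    exact (continuous_apply j).comp (KPow.continuous_coord.comp (hb.comp continuous_snd))

theorem James.continuous_prod_of_test {Y : Type u} [TopologicalSpace Y] (y₀ : Y) {K T : Type*}
    [TopologicalSpace K] [LocallyCompactSpace K] [TopologicalSpace T] (F : James y₀ × K → T)
    (h : ∀ (m : ℕ) (L : CompHaus.{u}) (a : C(L, KPow Y m)),
      Continuous fun p : L × K => F (James.proj y₀ ⟨m, a p.1⟩, p.2)) :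
    Continuous F := by
  refine (James.isQuotientMap_proj y₀).continuous_lift_prod_left ?_
  have h₁ : Continuous fun q : Σ m : ℕ, KPow Y m × K => F (James.proj y₀ ⟨q.1, q.2.1⟩, q.2.2) :=
    continuous_sigma fun m => CohenJames.continuous_prod_of_test
      (fun p : KPow Y m × K => F (James.proj y₀ ⟨m, p.1⟩, p.2)) (h m)
  exact h₁.comp (Homeomorph.sigmaProdDistrib (X := fun m => KPow Y m) (Y := K)).continuous

theorem James.continuous_proj_mul {Y : Type u} [TopologicalSpace Y] (y₀ : Y) {L : Type u}
    [TopologicalSpace L] [CompactSpace L] [T2Space L] (m : ℕ) (a : L → KPow Y m)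
    (ha : Continuous a) :
    Continuous fun p : James y₀ × L => James.proj y₀ ⟨m, a p.2⟩ * p.1 := by
  refine James.continuous_prod_of_test y₀
    (fun p : James y₀ × L => James.proj y₀ ⟨m, a p.2⟩ * p.1) fun m' L' b => ?_
  have h := James.continuous_mul_aux y₀ m m' a b ha b.continuous
  have hs : Continuous fun p : L' × L => (p.2, p.1) := continuous_swap
  have h' := Continuous.comp h hs
  exact h'

instance {Y : Type u} [TopologicalSpace Y] (y₀ : Y) : ContinuousKMul (James y₀) where
  continuous_mul_test K _ _ _ f g hf hg := by
    have step : Continuous fun p : James y₀ × K => p.1 * g p.2 := by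
      refine James.continuous_prod_of_test y₀ (fun p : James y₀ × K => p.1 * g p.2)
        fun m L a => ?_
      have h := James.continuous_proj_mul y₀ m a a.continuous
      have hs : Continuous fun p : L × K => (g p.2, p.1) :=
        (hg.comp continuous_snd).prodMk continuous_fst
      exact Continuous.comp h hs
    have hf' : Continuous fun x => (f x, x) := hf.prodMk continuous_id
    exact Continuous.comp step hf'

theorem continuous_kmul {W M : Type u} [TopologicalSpace W] [IsGeneratedBy compHausFamily.{u} W]
    [TopologicalSpace M] [Monoid M] [ContinuousKMul M] {f g : W → M} (hf : Continuous f)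
    (hg : Continuous g) : Continuous fun w => f w * g w := by
  rw [IsGeneratedBy.continuous_iff compHausFamily.{u}]
  intro L a
  exact ContinuousKMul.continuous_mul_test L _ _ (hf.comp a.continuous) (hg.comp a.continuous)

theorem continuous_kmul_homotopy {W M : Type u} [TopologicalSpace W]
    [IsGeneratedBy compHausFamily.{u} W] [TopologicalSpace M] [Monoid M] [ContinuousKMul M]
    {F G : I × W → M} (hF : Continuous F) (hG : Continuous G) :
    Continuous fun p => F p * G p := by
  have h : Continuous fun p : W × I => F (p.2, p.1) * G (p.2, p.1) := by
    refine continuous_prod_of_test _ fun L a => ?_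
    exact ContinuousKMul.continuous_mul_test (L × I) (fun p => F (p.2, a p.1))
      (fun p => G (p.2, a p.1)) (by fun_prop) (by fun_prop)
  exact h.comp continuous_swap

/-! ### Pointed homotopy classes of maps into a monoid -/

/-- Pointed maps from `(W, w₀)` to `M`, whose base point is the unit. -/
abbrev PointedMap {W : Type u} [TopologicalSpace W] (w₀ : W) (M : Type u) [TopologicalSpace M]
    [Monoid M] : Type u :=
  {f : C(W, M) // f w₀ = 1}

/-- Pointed homotopy. -/
def pointedHomotopySetoid {W : Type u} [TopologicalSpace W] (w₀ : W) (M : Type u)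
    [TopologicalSpace M] [Monoid M] : Setoid (PointedMap w₀ M) where
  r f g := f.1.HomotopicRel g.1 {w₀}
  iseqv :=
    { refl := fun f => ContinuousMap.HomotopicRel.refl f.1
      symm := fun h => h.symm
      trans := fun h h' => h.trans h' }

/-- The set `[W, M]` of pointed homotopy classes of pointed maps. -/
def PointedClasses {W : Type u} [TopologicalSpace W] (w₀ : W) (M : Type u) [TopologicalSpace M]
    [Monoid M] : Type u :=
  Quotient (pointedHomotopySetoid w₀ M)

section Classes

variable {W : Type u} [TopologicalSpace W] [IsGeneratedBy compHausFamily.{u} W] {w₀ : W}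
  {M : Type u} [TopologicalSpace M] [Monoid M] [ContinuousKMul M]

/-- The pointwise product of pointed maps. -/
instance : Mul (PointedMap w₀ M) where
  mul f g := ⟨⟨fun w => f.1 w * g.1 w, continuous_kmul f.1.continuous g.1.continuous⟩, by
    show f.1 w₀ * g.1 w₀ = 1
    rw [f.2, g.2, one_mul]⟩

/-- The constant map. -/
instance : One (PointedMap w₀ M) where
  one := ⟨ContinuousMap.const W 1, rfl⟩

theorem pointedMap_mul_homotopic {f f' g g' : PointedMap w₀ M}
    (h : f.1.HomotopicRel f'.1 {w₀}) (h' : g.1.HomotopicRel g'.1 {w₀}) :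
    (f * g).1.HomotopicRel (f' * g').1 {w₀} := by
  obtain ⟨F⟩ := h
  obtain ⟨G⟩ := h'
  refine ⟨⟨⟨⟨fun p => F p * G p, continuous_kmul_homotopy F.continuous G.continuous⟩,
    fun w => ?_, fun w => ?_⟩, fun t w hw => ?_⟩⟩
  · show F (0, w) * G (0, w) = f.1 w * g.1 w
    rw [F.apply_zero, G.apply_zero]
  · show F (1, w) * G (1, w) = f'.1 w * g'.1 w
    rw [F.apply_one, G.apply_one]
  · show F (t, w) * G (t, w) = f.1 w * g.1 w
    rw [F.eq_fst t hw, G.eq_fst t hw]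

/-- `[W, M]` is a monoid under pointwise multiplication of representatives. -/
instance : Monoid (PointedClasses w₀ M) where
  mul := Quotient.map₂ (· * ·) fun _ _ h _ _ h' => pointedMap_mul_homotopic h h'
  one := Quotient.mk _ 1
  mul_assoc := by
    rintro ⟨f⟩ ⟨g⟩ ⟨h⟩
    exact congrArg (Quotient.mk _)
      (Subtype.ext (ContinuousMap.ext fun w => mul_assoc (f.1 w) (g.1 w) (h.1 w)))
  one_mul := by
    rintro ⟨f⟩
    exact congrArg (Quotient.mk _)
      (Subtype.ext (ContinuousMap.ext fun w => one_mul (f.1 w)))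
  mul_one := by
    rintro ⟨f⟩
    exact congrArg (Quotient.mk _)
      (Subtype.ext (ContinuousMap.ext fun w => mul_one (f.1 w)))

end Classes

/-! ### Hypotheses on the space -/

/-- `x₀` is a non-degenerate base point: `(X, {x₀})` is an NDR pair. -/
def NondegenerateBasePoint {X : Type u} [TopologicalSpace X] (x₀ : X) : Prop :=
  ∃ (d : C(X, I)) (h : C(I × X, X)), (∀ x, d x = 0 ↔ x = x₀) ∧ (∀ x, h (0, x) = x) ∧
    (∀ t, h (t, x₀) = x₀) ∧ ∀ x, d x < 1 → h (1, x) = x₀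

/-- The reduced diagonal `X → X^(k)`, `x ↦ x ∧ ... ∧ x`. -/
def reducedDiagonal {X : Type u} [TopologicalSpace X] [CompactlyGeneratedSpace X] (x₀ : X)
    (k : ℕ) : C(X, Smash x₀ k) :=
  ⟨fun x => Smash.mk x₀ fun _ => x, Smash.continuous_mk x₀ (continuous_pi fun _ => continuous_id)⟩

/-- `X` has weak LS-category less than `k`: the `k`-fold reduced diagonal is null homotopic
(as a pointed map). -/
def WeakLSCatLT {X : Type u} [TopologicalSpace X] [CompactlyGeneratedSpace X] (x₀ : X)
    (k : ℕ) : Prop :=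
  (reducedDiagonal x₀ k).HomotopicRel (ContinuousMap.const X (Smash.base x₀ k)) {x₀}

/-- `X` has the homotopy type of a CW complex. -/
def HasCWHomotopyType (X : Type u) [TopologicalSpace X] : Prop :=
  ∃ (K : Type u) (_ : TopologicalSpace K) (_ : T2Space K),
    Nonempty (CWComplex (Set.univ : Set K)) ∧ Nonempty (ContinuousMap.HomotopyEquiv X K)

/-! ### The homotopy classes `{x_{i_1}|...|x_{i_k}}` -/

/-- The canonical inclusion `E : Y → J(Y)`. -/
def James.incl {Y : Type u} [TopologicalSpace Y] [IsGeneratedBy compHausFamily.{u} Y] (y₀ : Y) :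
    C(Y, James y₀) :=
  ⟨fun y => James.word y₀ [y], by
    have h : Continuous fun y : Y => (⟨1, KPow.mk fun _ => y⟩ : Σ m : ℕ, KPow Y m) :=
      continuous_sigmaMk.comp (KPow.continuous_mk (continuous_pi fun _ => continuous_id))
    exact (James.continuous_proj y₀).comp h⟩

/-- The map `X^n → X^(k)`, `(x_1, ..., x_n) ↦ x_{i_1} ∧ ... ∧ x_{i_k}`. -/
def smashProj {X : Type u} [TopologicalSpace X] (x₀ : X) {n k : ℕ} (i : Fin k → Fin n) :
    C(KPow X n, Smash x₀ k) :=
  ⟨fun v => Smash.mk x₀ fun j => v.coord (i j), Smash.continuous_mk x₀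
    (continuous_pi fun j => (continuous_apply (i j)).comp KPow.continuous_coord)⟩

/-- `[X^n, J(X^(k))]`, with the base point `(x₀, ..., x₀)` of `X^n`. -/
abbrev CohenTarget {X : Type u} [TopologicalSpace X] (x₀ : X) (n k : ℕ) : Type u :=
  PointedClasses (KPow.mk fun _ : Fin n => x₀) (James (Smash.base x₀ k))

/-- The class of the composite `X^n → X^(k) → J(X^(k))`. -/
def wordClass {X : Type u} [TopologicalSpace X] (x₀ : X) {n k : ℕ} (i : Fin k → Fin n) :
    CohenTarget x₀ n k :=
  Quotient.mk _ ⟨(James.incl (Smash.base x₀ k)).comp (smashProj x₀ i),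
    James.word_base (Smash.base x₀ k)⟩

/-! ### The combinatorial group `K_n(k)` -/

/-- The commutator `[x, y] = x⁻¹ y⁻¹ x y`. -/
def comm {G : Type*} [Group G] (x y : G) : G := x⁻¹ * y⁻¹ * x * y

/-- The iterated commutator `[...[[a_1, a_2], a_3], ..., a_l]`; equal to `a_1` if `l = 1`. -/
def iteratedComm {G : Type*} [Group G] : List G → G
  | [] => 1
  | a :: l => l.foldl comm a

/-- The relators of `K_n(k)`, in the free group on the words `{x_{i_1}|...|x_{i_k}}`. -/
inductive CohenRelator (n k : ℕ) : FreeGroup (Fin k → Fin n) → Prop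
  /-- A generator with a repeated index is trivial. -/
  | word (i : Fin k → Fin n) (hi : ¬ Function.Injective i) : CohenRelator n k (FreeGroup.of i)
  /-- An iterated commutator of generators is trivial if some index occurs twice in it. -/
  | comm (L : List (Fin k → Fin n)) (hL : ¬ (L.flatMap fun i => List.ofFn i).Nodup) :
      CohenRelator n k (iteratedComm (L.map FreeGroup.of))
  /-- Exponents may be taken out of iterated commutators of generators. -/
  | pow (L : List ((Fin k → Fin n) × ℤ)) :
      CohenRelator n k
        (iteratedComm (L.map fun p => FreeGroup.of p.1 ^ p.2) *
          (iteratedComm (L.map fun p => FreeGroup.of p.1) ^ (L.map fun p => p.2).prod)⁻¹)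

/-- The group `K_n(k)`. -/
abbrev CohenGroup (n k : ℕ) : Type :=
  PresentedGroup {r : FreeGroup (Fin k → Fin n) | CohenRelator n k r}

end CohenJames

/-! Part (b) rests on one principle, `homotopic_const_diagonal`: if a map on X^n becomes null
homotopic when either of two coordinates is set to x₀, then it is null homotopic on the diagonal of
these coordinates. Non-degeneracy of x₀ allows a deformation to a map that is constant where either
coordinate is x₀. That map factors through the smash square in the two coordinates, the diagonal
enters as x ∧ x, and weak category less than 2 contracts it. A repeated index, inside a word or
across the entries of a commutator, is split by a new coordinate; the resulting class dies when
either copy is x₀, so the principle gives relations 1 and 2 (`wordClass_eq_one`,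
`iteratedComm_wordClass_eq_one`). Relation 3 is then algebra: by relation 2 an iterated commutator
commutes with its entries (`iteratedComm_zpow`).

For part (a), J(X^(k)) is a path connected monoid. If the path components of a monoid form a group,
every map f from a CW complex to it has a right inverse up to homotopy, built over the cells
together with the homotopy from f·g to 1. The extension step is `exists_extension_rightInverse`:
over a ball f has a constant inverse b up to homotopy, and multiplying the boundary data by b, then
by f, turns them into data that extend. Powers of X follow from the exponential law, with maps from
X^n to M as a new target monoid (`HasRightInverses.kPow`). Finally the right inverse is made
pointed, and a monoid in which all elements have right inverses is a group. -/

namespace CohenJames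

/-! ### Retractions with a neighbourhood deformation -/

/-- The clamping map `ℝ → [0, 1]`. -/
noncomputable abbrev clamp (x : ℝ) : I := Set.projIcc (0 : ℝ) 1 zero_le_one x

theorem continuous_clamp : Continuous clamp := continuous_projIcc

theorem clamp_of_le_zero {x : ℝ} (h : x ≤ 0) : clamp x = 0 := Set.projIcc_of_le_left _ h

theorem clamp_of_one_le {x : ℝ} (h : 1 ≤ x) : clamp x = 1 := Set.projIcc_of_right_le _ h

/-- A map `r : W → W` onto a subspace together with a deformation of `W`, fixed on that subspace,
of a neighbourhood `d < 1` of the subspace onto it. -/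
structure NbhdRetract (W : Type*) [TopologicalSpace W] where
  /-- the function measuring the distance from the subspace -/
  d : C(W, I)
  /-- the deformation -/
  h : C(I × W, W)
  /-- the retraction -/
  r : C(W, W)
  h_zero : ∀ w, h (0, w) = w
  h_one : ∀ w, d w < 1 → h (1, w) = r w
  h_r : ∀ t w, h (t, r w) = r w
  d_r : ∀ w, d (r w) = 0

namespace NbhdRetract

variable {W T : Type*} [TopologicalSpace W] [TopologicalSpace T] (D : NbhdRetract W)

/-- The end of the deformation. -/
def last : C(W, W) := ⟨fun w => D.h (1, w), by fun_prop⟩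

/-- The deformation as a homotopy. -/
def homotopyLast : (ContinuousMap.id W).Homotopy D.last where
  toFun p := D.h p
  map_zero_left := D.h_zero
  map_one_left _ := rfl

theorem last_r (w : W) : D.last (D.r w) = D.r w := D.h_r 1 w

theorem last_of_le_half {w : W} (h : (D.d w : ℝ) ≤ 1 / 2) : D.last w = D.r w :=
  D.h_one w (Subtype.coe_lt_coe.1 (h.trans_lt (by rw [Set.Icc.coe_one]; norm_num)))

/-- If `c` is null homotopic on the image of the retraction, then `c` can be deformed to a map that
is constant there. -/
theorem exists_eq_on_range (c : C(W, T)) {t₀ : T}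
    (A : (c.comp D.r).Homotopy (ContinuousMap.const W t₀)) :
    ∃ c₁ : C(W, T), c.Homotopic c₁ ∧ (∀ w, c₁ (D.r w) = t₀) ∧
      ∀ w, (∀ t, A (t, w) = t₀) → c (D.last w) = t₀ → c₁ w = t₀ := by
  -- The homotopy starts at `c ∘ D.last`. Where d ≤ 1/2 this is `c ∘ D.r`, and the homotopy runs
  -- along `A`: all the way where d = 0, not at all where d = 1/2. Elsewhere it is stationary.
  let F : I × W → T := fun p => if (D.d p.2 : ℝ) ≤ 1 / 2 then
    A (clamp (p.1 * (1 - 2 * D.d p.2)), p.2) else c (D.last p.2)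
  have hF : Continuous F := by
    refine Continuous.if_le ?_ ?_ (by fun_prop) continuous_const ?_
    · exact A.continuous.comp (Continuous.prodMk (continuous_clamp.comp (by fun_prop)) (by fun_prop))
    · fun_prop
    · intro p hp
      rw [D.last_of_le_half hp.le, clamp_of_le_zero (by rw [hp]; norm_num), A.apply_zero]; rfl
  have h0 : ∀ w, F (0, w) = c (D.last w) := fun w => by
    by_cases h : (D.d w : ℝ) ≤ 1 / 2
    · simp only [F, if_pos h, D.last_of_le_half h]
      rw [clamp_of_le_zero (by simp), A.apply_zero]; rfl
    · simp only [F, if_neg h]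
  refine ⟨⟨fun w => F (1, w), by fun_prop⟩, ?_, fun w => ?_, fun w hA hc => ?_⟩
  · refine ContinuousMap.Homotopic.trans (g := c.comp D.last) ?_ ⟨⟨⟨F, hF⟩, h0, fun w => rfl⟩⟩
    exact ContinuousMap.Homotopic.comp (.refl c) ⟨D.homotopyLast⟩
  · have : (D.d (D.r w) : ℝ) = 0 := by rw [D.d_r]; rfl
    simp only [F, ContinuousMap.coe_mk, this]
    rw [if_pos (by norm_num), clamp_of_one_le (by simp), A.apply_one]; rfl
  · simp only [F, ContinuousMap.coe_mk]
    split_ifs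
    · exact hA _
    · exact hc

/-- A null homotopy of a map that is constant on the image of the retraction can be chosen
constant there. -/
theorem exists_homotopy_const (f : C(W, T)) {t₀ : T} (hf : ∀ w, f (D.r w) = t₀)
    (h : f.Homotopic (ContinuousMap.const W t₀)) :
    f.HomotopicRel (ContinuousMap.const W t₀) (Set.range D.r) := by
  obtain ⟨B⟩ := h
  have h₁ : f.HomotopicRel (f.comp D.last) (Set.range D.r) := by
    refine ⟨⟨(ContinuousMap.Homotopy.refl f).comp D.homotopyLast, ?_⟩⟩
    rintro t _ ⟨w, rfl⟩
    exact congrArg f (D.h_r t w)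
  refine h₁.trans ?_
  -- Up the null homotopy `B` along `D.last`, then back down along `D.r`, where `f` is `t₀`. The
  -- turning time is min(1, 2d): either d ≤ 1/2 and the two maps agree, or the time is 1 and `B` is
  -- constant. Where d = 0 the time stays 0 and nothing moves.
  let F : I × W → T := fun p => if (p.1 : ℝ) ≤ 1 / 2 then
    B (clamp (min 1 (2 * (D.d p.2 : ℝ)) * (2 * p.1)), D.last p.2) else
    B (clamp (min 1 (2 * (D.d p.2 : ℝ)) * (2 - 2 * p.1)), D.r p.2)
  have hF : Continuous F := by
    refine Continuous.if_le ?_ ?_ (by fun_prop) continuous_const ?_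
    · exact B.continuous.comp (Continuous.prodMk (continuous_clamp.comp (by fun_prop)) (by fun_prop))
    · exact B.continuous.comp (Continuous.prodMk (continuous_clamp.comp (by fun_prop)) (by fun_prop))
    · intro p hp
      have e : 2 - 2 * (p.1 : ℝ) = 2 * p.1 := by rw [hp]; norm_num
      rw [e]
      by_cases h : (D.d p.2 : ℝ) ≤ 1 / 2
      · rw [D.last_of_le_half h]
      · rw [clamp_of_one_le (by rw [min_eq_left (by linarith), hp]; norm_num), B.apply_one,
          B.apply_one]; rfl
  refine ⟨⟨⟨⟨F, hF⟩, fun w => ?_, fun w => ?_⟩, ?_⟩⟩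
  · simp only [F]
    rw [if_pos (by norm_num), clamp_of_le_zero (by simp), B.apply_zero]; rfl
  · simp only [F]
    rw [if_neg (by norm_num), clamp_of_le_zero (by simp), B.apply_zero, hf]; rfl
  · rintro t _ ⟨w, rfl⟩
    have : (D.d (D.r w) : ℝ) = 0 := by rw [D.d_r]; rfl
    have hfr : f (D.last (D.r w)) = t₀ := by rw [D.last_r, hf]
    simp only [F, ContinuousMap.coe_mk, ContinuousMap.comp_apply, hfr, this]
    split_ifs
    · rw [clamp_of_le_zero (by simp), B.apply_zero, hfr]
    · rw [clamp_of_le_zero (by simp), B.apply_zero, hf]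

end NbhdRetract

/-! ### Powers of a well-pointed space and their coordinate subspaces. -/

section Powers

variable {X : Type u} [TopologicalSpace X] {x₀ : X}

instance isGeneratedBy_prod_unitInterval (K : Type u) [TopologicalSpace K] [CompactSpace K]
    [T2Space K] : IsGeneratedBy compHausFamily.{u} (K × I) :=
  isGeneratedBy_of_compactlyGenerated (K × I)

theorem KPow.coord_mk {n : ℕ} (v : Fin n → X) : (KPow.mk v).coord = v := rfl

theorem KPow.mk_coord {n : ℕ} (v : KPow X n) : KPow.mk v.coord = v := rfl

theorem KPow.continuous_coord_apply {n : ℕ} (i : Fin n) : Continuous fun v : KPow X n => v.coord i :=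
  (continuous_apply i).comp KPow.continuous_coord

/-- Continuity on `[0, 1] × X^n` of maps to powers of `X`. -/
theorem KPow.continuous_mk_unitInterval {W : Type u} [TopologicalSpace W]
    [IsGeneratedBy compHausFamily.{u} W] {n : ℕ} {f : I × W → Fin n → X} (hf : Continuous f) :
    Continuous fun p => KPow.mk (f p) := by
  have h : Continuous fun p : W × I => KPow.mk (f (p.2, p.1)) := by
    refine continuous_prod_of_test _ fun L a => ?_
    exact KPow.continuous_mk (W := L × I) (f := fun p => f (p.2, a p.1)) (by fun_prop)
  exact h.comp continuous_swap

/-- The base point of a power of a well-pointed space is non-degenerate. -/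
theorem exists_nbhdRetract_base (hx₀ : NondegenerateBasePoint x₀) (n : ℕ) :
    ∃ D : NbhdRetract (KPow X n), ∀ w, D.r w = KPow.mk fun _ => x₀ := by
  obtain ⟨d, h, hd, h0, hb, h1⟩ := hx₀
  have hd₀ : d x₀ = 0 := (hd x₀).2 rfl
  refine ⟨{
    -- With the maximum, d < 1 forces every coordinate to reach x₀ at time 1.
    d := ⟨fun v => Finset.univ.sup fun i => d (v.coord i), ?_⟩
    h := ⟨fun p => KPow.mk fun i => h (p.1, p.2.coord i), ?_⟩
    r := ContinuousMap.const _ (KPow.mk fun _ => x₀)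
    h_zero := fun w => congrArg KPow.mk (funext fun i => h0 _)
    h_one := fun w hw => congrArg KPow.mk (funext fun i => h1 _ ?_)
    h_r := fun t w => congrArg KPow.mk (funext fun i => hb t)
    d_r := fun w => ?_ }, fun w => rfl⟩
  · exact Continuous.finset_sup_apply fun i _ => d.continuous.comp (KPow.continuous_coord_apply i)
  · refine KPow.continuous_mk_unitInterval (continuous_pi fun i => h.continuous.comp ?_)
    exact continuous_fst.prodMk ((KPow.continuous_coord_apply i).comp continuous_snd)
  · exact (Finset.le_sup (f := fun i => d (w.coord i)) (Finset.mem_univ i)).trans_lt hw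
  · have h : (Finset.univ.sup fun _ : Fin n => d x₀) ≤ 0 := Finset.sup_le fun i _ => hd₀.le
    exact le_antisymm h bot_le

/-- Replacing one coordinate of a point by another value. -/
def KPow.update {n : ℕ} (v : KPow X n) (i : Fin n) (x : X) : KPow X n :=
  KPow.mk (Function.update v.coord i x)

/-- The subspace of the power where the `i`-th coordinate is the base point. -/
theorem exists_nbhdRetract_coord (hx₀ : NondegenerateBasePoint x₀) {n : ℕ} (i : Fin n) :
    ∃ D : NbhdRetract (KPow X n), (∀ w, D.r w = w.update i x₀) ∧
      ∀ w, ∃ x, D.last w = w.update i x := by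
  obtain ⟨d, h, hd, h0, hb, h1⟩ := hx₀
  have hr : Continuous fun v : KPow X n => v.update i x₀ :=
    KPow.continuous_mk (KPow.continuous_coord.update i continuous_const)
  refine ⟨{
    d := ⟨fun v => d (v.coord i), d.continuous.comp (KPow.continuous_coord_apply i)⟩
    h := ⟨fun p => p.2.update i (h (p.1, p.2.coord i)), ?_⟩
    r := ⟨fun v => v.update i x₀, hr⟩
    h_zero := fun w => ?_
    h_one := fun w hw => ?_
    h_r := fun t w => ?_
    d_r := fun w => ?_ }, fun w => rfl, fun w => ⟨_, rfl⟩⟩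
  · refine KPow.continuous_mk_unitInterval ((KPow.continuous_coord.comp continuous_snd).update i
      (h.continuous.comp ?_))
    exact continuous_fst.prodMk ((KPow.continuous_coord_apply i).comp continuous_snd)
  · simp [h0, KPow.update, KPow.mk_coord]
  · exact congrArg (w.update i) (h1 _ hw)
  · simp [KPow.update, KPow.coord_mk, hb]
  · simpa [KPow.update, KPow.coord_mk] using (hd x₀).2 rfl

end Powers

/-! ### Null homotopies on partial diagonals. -/

section Diagonal

variable {X : Type u} [TopologicalSpace X] {x₀ : X} {n : ℕ} {T : Type*} [TopologicalSpace T]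

instance isGeneratedBy_prod_compact (K L : Type u) [TopologicalSpace K] [CompactSpace K]
    [T2Space K] [TopologicalSpace L] [CompactSpace L] [T2Space L] :
    IsGeneratedBy compHausFamily.{u} (K × L) :=
  isGeneratedBy_of_compactlyGenerated (K × L)

theorem KPow.continuous_update (i : Fin n) (x : X) : Continuous fun v : KPow X n => v.update i x :=
  KPow.continuous_mk (KPow.continuous_coord.update i continuous_const)

/-- Replacing one coordinate by a constant, as a continuous map. -/
def KPow.updateMap (i : Fin n) (x : X) : C(KPow X n, KPow X n) :=
  ⟨fun v => v.update i x, KPow.continuous_update i x⟩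

/-- The map of powers given by a map of the index sets. -/
def KPow.reindex {m : ℕ} (φ : Fin m → Fin n) : C(KPow X n, KPow X m) :=
  ⟨fun v => KPow.mk (v.coord ∘ φ), KPow.continuous_mk
    (continuous_pi fun j => KPow.continuous_coord_apply (φ j))⟩

theorem KPow.update_comm {i j : Fin n} (h : i ≠ j) (v : KPow X n) (x y : X) :
    (v.update i x).update j y = (v.update j y).update i x := by
  simp only [KPow.update, KPow.coord_mk]
  rw [Function.update_comm h]

theorem KPow.update_self (i : Fin n) (v : KPow X n) : v.update i (v.coord i) = v := by
  simp [KPow.update, KPow.mk_coord]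

/-- A map that is null homotopic on the subspaces given by the vanishing of either one of two
coordinates can be deformed to a map that is constant on both. -/
theorem exists_eq_of_update (hx₀ : NondegenerateBasePoint x₀) {i j : Fin n} (hij : i ≠ j)
    (c : C(KPow X n, T)) {t₀ : T}
    (hi : (c.comp (KPow.updateMap i x₀)).Homotopic (.const _ t₀))
    (hj : (c.comp (KPow.updateMap j x₀)).Homotopic (.const _ t₀)) :
    ∃ c' : C(KPow X n, T), c.Homotopic c' ∧ (∀ v, v.coord i = x₀ → c' v = t₀) ∧
      ∀ v, v.coord j = x₀ → c' v = t₀ := by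
  obtain ⟨Di, hDi, -⟩ := exists_nbhdRetract_coord hx₀ i
  obtain ⟨Dj, hDj, hlast⟩ := exists_nbhdRetract_coord hx₀ j
  have ei : Di.r = KPow.updateMap i x₀ := ContinuousMap.ext hDi
  have ej : Dj.r = KPow.updateMap j x₀ := ContinuousMap.ext hDj
  rw [← ei] at hi
  rw [← ej] at hj
  obtain ⟨A⟩ := hi
  obtain ⟨c₁, hc₁, h₁, -⟩ := Di.exists_eq_on_range c A
  -- The two retractions commute, so `c₁ ∘ Dj.r` is already `t₀` where the i-th coordinate is x₀,
  -- and its null homotopy can be kept stationary there. The second deformation then does not spoil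
  -- the first.
  obtain ⟨A'⟩ := Di.exists_homotopy_const (c₁.comp Dj.r) (t₀ := t₀)
    (fun w => by rw [ContinuousMap.comp_apply, hDj, hDi, KPow.update_comm hij, ← hDi, h₁])
    ((hc₁.symm.comp (.refl Dj.r)).trans hj)
  obtain ⟨c₂, hc₂, h₂, h₂'⟩ := Dj.exists_eq_on_range c₁ A'.toHomotopy
  refine ⟨c₂, hc₁.trans hc₂, fun v hv => ?_, fun v hv => ?_⟩
  · have hv' : v = Di.r v := by rw [hDi, ← hv, KPow.update_self]
    refine h₂' v (fun t => ?_) ?_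
    · have := A'.eq_snd t (x := v) ⟨v, hv'.symm⟩
      exact this
    · obtain ⟨x, hx⟩ := hlast v
      rw [hx, hv', hDi, KPow.update_comm hij, ← hDi, h₁]
  · have hv' : v = Dj.r v := by rw [hDj, ← hv, KPow.update_self]
    exact (congrArg c₂ hv').trans (h₂ v)

/-- A map on `X^n`, evaluated at a point two of whose coordinates are replaced by those of a point
of the smash square. -/
def smashLift {i j : Fin n} (c : C(KPow X n, T)) {t₀ : T}
    (hi : ∀ v, v.coord i = x₀ → c v = t₀) (hj : ∀ v, v.coord j = x₀ → c v = t₀) (hij : i ≠ j)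
    (v : KPow X n) : Smash x₀ 2 → T :=
  Quotient.lift (fun p : KPow X 2 => c ((v.update i (p.coord 0)).update j (p.coord 1))) (by
    have key : ∀ p : KPow X 2, (∃ k, p.coord k = x₀) →
        c ((v.update i (p.coord 0)).update j (p.coord 1)) = t₀ := by
      rintro p ⟨k, hk⟩
      fin_cases k
      · refine hi _ ?_
        simpa [KPow.update, KPow.coord_mk, Function.update_of_ne hij] using hk
      · refine hj _ ?_
        simpa [KPow.update, KPow.coord_mk] using hk
    rintro p q (rfl | ⟨hp, hq⟩)
    · rfl
    · rw [key p hp, key q hq])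

/-- The projection onto the smash square stays a quotient map after multiplication by a locally
compact space; hence the parameter ranges over a compact test space `L`. -/
theorem continuous_smashLift {i j : Fin n} (c : C(KPow X n, T)) {t₀ : T}
    (hi : ∀ v, v.coord i = x₀ → c v = t₀) (hj : ∀ v, v.coord j = x₀ → c v = t₀) (hij : i ≠ j)
    {L : Type u} [TopologicalSpace L] [CompactSpace L] [T2Space L] {a : L → KPow X n}
    (ha : Continuous a) :
    Continuous fun p : Smash x₀ 2 × L => smashLift c hi hj hij (a p.2) p.1 := by
  refine IsQuotientMap.continuous_lift_prod_left
    (f := (Quotient.mk (smashSetoid x₀ 2))) isQuotientMap_quotient_mk' ?_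
  refine continuous_prod_of_test (fun p : KPow X 2 × L =>
    c (((a p.2).update i (p.1.coord 0)).update j (p.1.coord 1))) fun L' b => ?_
  refine c.continuous.comp (KPow.continuous_mk (W := L' × L) ?_)
  have hb : ∀ k, Continuous fun p : L' × L => (b p.1).coord k := fun k =>
    (KPow.continuous_coord_apply k).comp (b.continuous.comp continuous_fst)
  exact ((KPow.continuous_coord.comp (ha.comp continuous_snd)).update i (hb 0)).update j (hb 1)

theorem continuous_smashLift_homotopy {m : ℕ} {i j : Fin n} (c : C(KPow X n, T)) {t₀ : T}
    (hi : ∀ v, v.coord i = x₀ → c v = t₀) (hj : ∀ v, v.coord j = x₀ → c v = t₀) (hij : i ≠ j)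
    (φ : Fin n → Fin m) {N : I × X → Smash x₀ 2} (hN : Continuous N) :
    Continuous fun p : I × KPow X m =>
      smashLift c hi hj hij (KPow.reindex φ p.2) (N (p.1, p.2.coord (φ i))) := by
  have h : Continuous fun p : KPow X m × I =>
      smashLift c hi hj hij (KPow.reindex φ p.1) (N (p.2, p.1.coord (φ i))) := by
    refine continuous_prod_of_test _ fun L a => ?_
    have ha : Continuous fun l : L => KPow.reindex φ (a l) :=
      (KPow.reindex φ).continuous.comp a.continuous
    have ha' : Continuous fun l : L => (a l).coord (φ i) :=
      (KPow.continuous_coord_apply (φ i)).comp a.continuous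
    have h₂ : Continuous fun p : L × I => (N (p.2, (a p.1).coord (φ i)), p.1) :=
      (hN.comp (continuous_snd.prodMk (ha'.comp continuous_fst))).prodMk continuous_fst
    have h₃ := (continuous_smashLift c hi hj hij ha).comp h₂
    exact h₃
  have hs : Continuous fun p : I × KPow X m => (p.2, p.1) := continuous_swap
  have key := h.comp hs
  exact key

/-- If the reduced diagonal of `X` is null homotopic, then so is the restriction to a partial
diagonal of a map that is null homotopic as soon as one of two coordinates is trivial. -/
theorem homotopic_const_diagonal [CompactlyGeneratedSpace X] (hx₀ : NondegenerateBasePoint x₀)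
    (hcat : WeakLSCatLT x₀ 2) {m : ℕ} {i j : Fin n} (hij : i ≠ j) (φ : Fin n → Fin m)
    (hφ : φ i = φ j) (c : C(KPow X n, T)) {t₀ : T}
    (hi : (c.comp (KPow.updateMap i x₀)).Homotopic (.const _ t₀))
    (hj : (c.comp (KPow.updateMap j x₀)).Homotopic (.const _ t₀)) :
    (c.comp (KPow.reindex φ)).Homotopic (.const _ t₀) := by
  obtain ⟨c', hc', hi', hj'⟩ := exists_eq_of_update hx₀ hij c hi hj
  refine (hc'.comp (.refl _)).trans ?_
  obtain ⟨N⟩ := hcat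
  -- On the diagonal the coordinates i and j are both x = `p.2.coord (φ i)`, so the smash variable
  -- starts at x ∧ x and is moved to the base point by `N`.
  refine ⟨⟨⟨fun p => smashLift c' hi' hj' hij (KPow.reindex φ p.2) (N (p.1, p.2.coord (φ i))), ?_⟩,
    fun v => ?_, fun v => ?_⟩⟩
  · exact continuous_smashLift_homotopy c' hi' hj' hij φ N.continuous
  · simp only [N.apply_zero]
    show c' (((KPow.reindex φ v).update i (v.coord (φ i))).update j (v.coord (φ i))) = _
    have e1 := KPow.update_self i (KPow.reindex φ v)
    have e2 := KPow.update_self j (KPow.reindex φ v)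
    change (KPow.reindex φ v).update i (v.coord (φ i)) = _ at e1
    change (KPow.reindex φ v).update j (v.coord (φ j)) = _ at e2
    rw [e1, hφ, e2]; rfl
  · simp only [N.apply_one]
    refine hi' _ ?_
    simp [KPow.update, KPow.coord_mk, Function.update_of_ne hij]

end Diagonal

/-! ### Iterated commutators -/

section Commutators

variable {G H : Type*} [Group G] [Group H]

theorem map_comm (f : G →* H) (x y : G) : f (comm x y) = comm (f x) (f y) := by
  simp [comm]

theorem map_foldl_comm (f : G →* H) (l : List G) (a : G) :
    f (l.foldl comm a) = (l.map f).foldl comm (f a) := by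
  induction l generalizing a with
  | nil => rfl
  | cons b l ih => simp [ih, map_comm]

theorem map_iteratedComm (f : G →* H) (l : List G) :
    f (iteratedComm l) = iteratedComm (l.map f) := by
  cases l with
  | nil => exact map_one f
  | cons a l => exact map_foldl_comm f l a

theorem foldl_comm_one (l : List G) : l.foldl comm (1 : G) = 1 := by
  induction l with
  | nil => rfl
  | cons b l ih => simpa [comm] using ih

theorem foldl_comm_eq_one {l : List G} (h : (1 : G) ∈ l) (a : G) : l.foldl comm a = 1 := by
  induction l generalizing a with
  | nil => simp at h
  | cons b l ih =>
    rcases List.mem_cons.1 h with rfl | h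
    · simpa [comm] using foldl_comm_one l
    · exact ih h _

theorem iteratedComm_eq_one {l : List G} (h : (1 : G) ∈ l) : iteratedComm l = 1 := by
  cases l with
  | nil => rfl
  | cons a l =>
    rcases List.mem_cons.1 h with rfl | h
    · exact foldl_comm_one l
    · exact foldl_comm_eq_one h a

theorem iteratedComm_append_singleton {l : List G} (hl : l ≠ []) (x : G) :
    iteratedComm (l ++ [x]) = comm (iteratedComm l) x := by
  cases l with
  | nil => exact absurd rfl hl
  | cons a l => simp [iteratedComm]

theorem comm_eq_one_iff {x y : G} : comm x y = 1 ↔ Commute x y := by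
  rw [comm, Commute, SemiconjBy]
  constructor
  · intro h
    have : y * x * (x⁻¹ * y⁻¹ * x * y) = y * x := by rw [h, mul_one]
    rw [← this]; group
  · intro h
    have : x⁻¹ * y⁻¹ * x * y = (y * x)⁻¹ * (x * y) := by group
    rw [this, h]; group

theorem commute_iteratedComm {v : G} {l : List G} (h : ∀ x ∈ l, Commute v x) :
    Commute v (iteratedComm l) := by
  have key : ∀ (l : List G) (a : G), Commute v a → (∀ x ∈ l, Commute v x) →
      Commute v (l.foldl comm a) := by
    intro l
    induction l with
    | nil => exact fun a ha _ => ha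
    | cons b l ih =>
      intro a ha hl
      have hb := hl b List.mem_cons_self
      exact ih _ (((ha.inv_right.mul_right hb.inv_right).mul_right ha).mul_right hb)
        fun x hx => hl x (List.mem_cons_of_mem _ hx)
  cases l with
  | nil => exact Commute.one_right v
  | cons a l =>
    exact key l a (h a List.mem_cons_self) fun x hx => h x (List.mem_cons_of_mem _ hx)

/-- Exponents may be taken out of a commutator that commutes with its entries. -/
theorem comm_zpow_zpow {x y : G} (hx : Commute (comm x y) x) (hy : Commute (comm x y) y)
    (a b : ℤ) : comm (x ^ a) (y ^ b) = comm x y ^ (a * b) := by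
  -- Here y⁻¹xy = x[x, y] is raised to the power a, which splits since the factors commute. The
  -- second exponent is treated likewise, with x ^ a in place of x.
  have h₁ : comm (x ^ a) y = comm x y ^ a := by
    have e : y⁻¹ * x * y⁻¹⁻¹ = x * comm x y := by simp [comm]; group
    have e' : y⁻¹ * x ^ a * y⁻¹⁻¹ = x ^ a * comm x y ^ a := by
      rw [← conj_zpow, e, hx.symm.mul_zpow]
    have : comm (x ^ a) y = (x ^ a)⁻¹ * (y⁻¹ * x ^ a * y⁻¹⁻¹) := by simp only [comm]; group
    rw [this, e']; group
  have hy' : Commute (comm x y ^ a) y := hy.zpow_left a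
  rw [zpow_mul, ← h₁]
  rw [← h₁] at hy'
  generalize x ^ a = z at *
  have e : z⁻¹ * y⁻¹ * z⁻¹⁻¹ = comm z y * y⁻¹ := by simp [comm]
  have e' : z⁻¹ * y⁻¹ ^ b * z⁻¹⁻¹ = comm z y ^ b * y⁻¹ ^ b := by
    rw [← conj_zpow, e, hy'.inv_right.mul_zpow]
  have : comm z (y ^ b) = z⁻¹ * y⁻¹ ^ b * z⁻¹⁻¹ * y ^ b := by simp only [comm]; group
  rw [this, e']; group

/-- If the iterated commutators of the `u i` with repetitions are trivial, then exponents may be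
taken out of all iterated commutators of the `u i`. -/
theorem iteratedComm_zpow {ι : Type*} (u : ι → G)
    (hu : ∀ l : List ι, ¬ l.Nodup → iteratedComm (l.map u) = 1) (L : List (ι × ℤ)) :
    iteratedComm (L.map fun p => u p.1 ^ p.2) =
      iteratedComm (L.map fun p => u p.1) ^ (L.map fun p => p.2).prod := by
  induction L using List.reverseRecOn with
  | nil => simp [iteratedComm]
  | append_singleton L p ih =>
    rcases eq_or_ne L [] with rfl | hL
    · simp [iteratedComm]
    -- Appending an entry that already occurs gives a list with a repetition, so the longer
    -- commutator is trivial.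
    have hcomm : ∀ i ∈ (L ++ [p]).map Prod.fst,
        Commute (iteratedComm ((L ++ [p]).map fun p => u p.1)) (u i) := by
      intro i hi
      rw [← comm_eq_one_iff, ← iteratedComm_append_singleton (by simp)]
      have := hu ((L ++ [p]).map Prod.fst ++ [i]) fun h =>
        (List.nodup_append.1 h).2.2 i hi i (List.mem_singleton_self i) rfl
      simpa [Function.comp_def] using this
    simp only [List.map_append, List.map_cons, List.map_nil, List.prod_append, List.prod_singleton]
    rw [iteratedComm_append_singleton (by simpa using hL),
      iteratedComm_append_singleton (by simpa using hL), ih]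
    simp only [List.map_append, List.map_cons, List.map_nil] at hcomm
    rw [iteratedComm_append_singleton (by simpa using hL)] at hcomm
    refine comm_zpow_zpow (commute_iteratedComm ?_) (hcomm _ (by simp)) _ _
    intro x hx
    obtain ⟨q, hq, rfl⟩ := List.mem_map.1 hx
    exact hcomm _ (List.mem_append_left _ (List.mem_map_of_mem hq))

end Commutators

/-- The list is cut after `x`, between the members of a failing pair; below, the two parts are moved
to different coordinates. -/
theorem exists_of_not_pairwise {α : Type*} {R : α → α → Prop} {L : List α}
    (h : ¬ L.Pairwise R) : ∃ l₁ x l₂ y, L = l₁ ++ x :: l₂ ∧ y ∈ l₂ ∧ ¬ R x y := by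
  induction L with
  | nil => exact absurd List.Pairwise.nil h
  | cons a L ih =>
    rw [List.pairwise_cons, not_and_or] at h
    rcases h with h | h
    · push Not at h
      obtain ⟨y, hy, hR⟩ := h
      exact ⟨[], a, L, y, rfl, hy, hR⟩
    · obtain ⟨l₁, x, l₂, y, rfl, hy, hR⟩ := ih h
      exact ⟨a :: l₁, x, l₂, y, rfl, hy, hR⟩

/-! ### Functoriality of the pointed homotopy classes -/

section Pullback

variable {W W' : Type u} [TopologicalSpace W] [IsGeneratedBy compHausFamily.{u} W]
  [TopologicalSpace W'] [IsGeneratedBy compHausFamily.{u} W'] {w₀ : W} {w₀' : W'}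
  {M : Type u} [TopologicalSpace M] [Monoid M] [ContinuousKMul M]

/-- The pointed homotopy class of a pointed map. -/
def PointedClasses.mk (f : PointedMap w₀ M) : PointedClasses w₀ M := Quotient.mk _ f

/-- Composition with a pointed map, on pointed homotopy classes. -/
def PointedClasses.pullback (φ : C(W', W)) (hφ : φ w₀' = w₀) :
    PointedClasses w₀ M →* PointedClasses w₀' M where
  toFun := Quotient.map (fun f => ⟨f.1.comp φ, by
    rw [ContinuousMap.comp_apply, hφ, f.2]⟩) fun f g ⟨F⟩ =>
      ⟨⟨⟨⟨fun p => F (p.1, φ p.2), by fun_prop⟩, fun w => F.apply_zero _, fun w => F.apply_one _⟩, by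
        rintro t _ rfl
        exact F.eq_fst t hφ⟩⟩
  map_one' := rfl
  map_mul' := by
    rintro ⟨f⟩ ⟨g⟩
    rfl

theorem PointedClasses.homotopic_of_eq_one {f : PointedMap w₀ M}
    (h : PointedClasses.mk f = 1) : f.1.Homotopic (.const W 1) := by
  obtain ⟨F⟩ : f.1.HomotopicRel (.const W 1) {w₀} := Quotient.exact h
  exact ⟨F.toHomotopy⟩

end Pullback

/-! ### Pointed classes on powers and their behaviour under reindexing. -/

section Classes

variable {X : Type u} [TopologicalSpace X] {x₀ : X} {n : ℕ} {M : Type u} [TopologicalSpace M]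
  [Monoid M] [ContinuousKMul M]

/-- A freely null homotopic pointed map on a power of a well-pointed space is null homotopic. -/
theorem PointedClasses.eq_one_of_homotopic (hx₀ : NondegenerateBasePoint x₀)
    {f : PointedMap (KPow.mk fun _ : Fin n => x₀) M} (h : f.1.Homotopic (.const _ 1)) :
    PointedClasses.mk f = 1 := by
  obtain ⟨D, hD⟩ := exists_nbhdRetract_base hx₀ n
  have h' := D.exists_homotopy_const f.1 (fun w => by rw [hD, f.2]) h
  have hr : Set.range D.r = {KPow.mk fun _ : Fin n => x₀} := by
    ext w
    constructor
    · rintro ⟨v, rfl⟩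
      exact hD v
    · rintro rfl
      exact ⟨KPow.mk fun _ => x₀, hD _⟩
  rw [hr] at h'
  exact Quotient.sound (s := pointedHomotopySetoid _ M) (b := 1) h'

theorem KPow.updateMap_base (i : Fin n) :
    KPow.updateMap i x₀ (KPow.mk fun _ => x₀) = KPow.mk fun _ => x₀ :=
  KPow.update_self i _

theorem KPow.reindex_base {m : ℕ} (φ : Fin m → Fin n) :
    KPow.reindex φ (KPow.mk fun _ => x₀) = KPow.mk fun _ => x₀ := rfl

/-- The pointed form of `homotopic_const_diagonal`; its free null homotopy can be made pointed
because the base point is non-degenerate. -/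
theorem PointedClasses.pullback_diagonal_eq_one [CompactlyGeneratedSpace X]
    (hx₀ : NondegenerateBasePoint x₀) (hcat : WeakLSCatLT x₀ 2) {m : ℕ} {i j : Fin n} (hij : i ≠ j)
    (φ : Fin n → Fin m) (hφ : φ i = φ j) (c : PointedClasses (KPow.mk fun _ : Fin n => x₀) M)
    (hi : PointedClasses.pullback (KPow.updateMap i x₀) (KPow.updateMap_base i) c = 1)
    (hj : PointedClasses.pullback (KPow.updateMap j x₀) (KPow.updateMap_base j) c = 1) :
    PointedClasses.pullback (KPow.reindex φ) (KPow.reindex_base φ) c = 1 := by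
  obtain ⟨f⟩ := c
  exact PointedClasses.eq_one_of_homotopic hx₀ (homotopic_const_diagonal hx₀ hcat hij φ hφ f.1
    (PointedClasses.homotopic_of_eq_one hi) (PointedClasses.homotopic_of_eq_one hj))

/-- Reindexing, on homotopy classes. -/
abbrev reindexClass (x₀ : X) (k : ℕ) {m : ℕ} (φ : Fin n → Fin m) :
    CohenTarget x₀ n k →* CohenTarget x₀ m k :=
  PointedClasses.pullback (KPow.reindex φ) (KPow.reindex_base φ)

/-- Setting one coordinate to the base point, on homotopy classes. -/
abbrev updateClass (x₀ : X) (k : ℕ) (i : Fin n) : CohenTarget x₀ n k →* CohenTarget x₀ n k :=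
  PointedClasses.pullback (KPow.updateMap i x₀) (KPow.updateMap_base i)

theorem reindexClass_wordClass {k m : ℕ} (φ : Fin n → Fin m) (i : Fin k → Fin n) :
    reindexClass x₀ k φ (wordClass x₀ i) = wordClass x₀ (φ ∘ i) := rfl

theorem reindexClass_comp {k m l : ℕ} (φ : Fin n → Fin m) (ψ : Fin m → Fin l)
    (a : CohenTarget x₀ n k) :
    reindexClass x₀ k ψ (reindexClass x₀ k φ a) = reindexClass x₀ k (ψ ∘ φ) a := by
  obtain ⟨f⟩ := a
  rfl

theorem reindexClass_id {k : ℕ} (a : CohenTarget x₀ n k) : reindexClass x₀ k id a = a := by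
  obtain ⟨f⟩ := a
  rfl

theorem updateClass_wordClass {k : ℕ} {i : Fin k → Fin n} {j : Fin n} (h : ∃ s, i s = j) :
    updateClass x₀ k j (wordClass x₀ i) = 1 := by
  obtain ⟨s, rfl⟩ := h
  refine congrArg (Quotient.mk _) (Subtype.ext (ContinuousMap.ext fun v => ?_))
  show James.word (Smash.base x₀ k) [Smash.mk x₀ _] = 1
  rw [Smash.mk_eq_base, James.word_base]
  exact ⟨s, by simp [KPow.updateMap, KPow.update, KPow.coord_mk]⟩

/-! ### The relations of K_n(k) for the word classes. -/

section Relations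

variable [CompactlyGeneratedSpace X]

/-- Position `t` of the word receives a new last coordinate, which the diagonal `φ` identifies with
the old one. The new word lands in the fat wedge when either of the two coordinates is x₀. -/
theorem wordClass_eq_one (hx₀ : NondegenerateBasePoint x₀) (hcat : WeakLSCatLT x₀ 2) {k : ℕ}
    {i : Fin k → Fin n} (hi : ¬ Function.Injective i) : wordClass x₀ i = 1 := by
  obtain ⟨s, t, h, hst⟩ : ∃ s t, i s = i t ∧ s ≠ t := by
    simpa [Function.Injective] using hi
  let i' : Fin k → Fin (n + 1) := Function.update (fun r => (i r).castSucc) t (Fin.last n)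
  let φ : Fin (n + 1) → Fin n := Fin.snoc id (i t)
  have hφ : φ ∘ i' = i := by
    funext r
    rcases eq_or_ne r t with rfl | hr
    · simp [φ, i']
    · simp [φ, i', Function.update_of_ne hr]
  rw [← hφ, ← reindexClass_wordClass]
  refine PointedClasses.pullback_diagonal_eq_one hx₀ hcat
    (i := (i t).castSucc) (j := Fin.last n) (Fin.castSucc_lt_last _).ne φ (by simp [φ]) _ ?_ ?_
  · exact updateClass_wordClass ⟨s, by simp [i', Function.update_of_ne hst, h]⟩
  · exact updateClass_wordClass ⟨t, by simp [i']⟩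

/-- An index p shared by two entries is doubled: entries up to `x` keep p, later ones use a new
coordinate instead. Setting either copy to x₀ kills an entry, hence the commutator, and the diagonal
`δ` gives back the original one. Commutators are formed among units, so the classes in n + 1
coordinates need not form a group. -/
theorem iteratedComm_wordClass_eq_one (hx₀ : NondegenerateBasePoint x₀) (hcat : WeakLSCatLT x₀ 2)
    {k : ℕ} (u : (Fin k → Fin n) → (CohenTarget x₀ n k)ˣ) (hu : ∀ i, (u i : CohenTarget x₀ n k) =
      wordClass x₀ i) (L : List (Fin k → Fin n))
    (hL : ¬ (L.flatMap fun i => List.ofFn i).Nodup) : iteratedComm (L.map u) = 1 := by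
  by_cases hinj : ∀ i ∈ L, Function.Injective i
  swap
  · push Not at hinj
    obtain ⟨i, hi, hinj⟩ := hinj
    refine iteratedComm_eq_one (List.mem_map.2 ⟨i, hi, Units.ext ?_⟩)
    rw [hu, wordClass_eq_one hx₀ hcat hinj]; rfl
  rw [List.nodup_flatMap, not_and_or] at hL
  rcases hL with hL | hL
  · exact absurd (fun i hi => List.nodup_ofFn.2 (hinj i hi)) hL
  obtain ⟨l₁, x, l₂, y, rfl, hy, hxy⟩ := exists_of_not_pairwise hL
  obtain ⟨p, hpx, hpy⟩ : ∃ p, p ∈ List.ofFn x ∧ p ∈ List.ofFn y := by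
    simpa [Function.onFun, List.Disjoint] using hxy
  obtain ⟨s, hs⟩ := (List.mem_ofFn' _ _).1 hpx
  obtain ⟨t, ht⟩ := (List.mem_ofFn' _ _).1 hpy
  let φ : Fin n → Fin (n + 1) := Function.update Fin.castSucc p (Fin.last n)
  let δ : Fin (n + 1) → Fin n := Fin.snoc id p
  have h₁ : δ ∘ Fin.castSucc = id := by funext r; simp [δ]
  have h₂ : δ ∘ φ = id := by
    funext r
    rcases eq_or_ne r p with rfl | hr
    · simp [φ, δ]
    · simp [φ, δ, Function.update_of_ne hr]
  let a : (CohenTarget x₀ n k)ˣ →* (CohenTarget x₀ (n + 1) k)ˣ :=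
    Units.map (reindexClass x₀ k Fin.castSucc)
  let b : (CohenTarget x₀ n k)ˣ →* (CohenTarget x₀ (n + 1) k)ˣ := Units.map (reindexClass x₀ k φ)
  let c := iteratedComm (((l₁ ++ [x]).map u).map a ++ (l₂.map u).map b)
  have hc : Units.map (reindexClass x₀ k δ) c = iteratedComm ((l₁ ++ x :: l₂).map u) := by
    have ha : ∀ g, Units.map (reindexClass x₀ k δ) (a g) = g := fun g => Units.ext <| by
      show reindexClass x₀ k δ (reindexClass x₀ k Fin.castSucc (g : CohenTarget x₀ n k)) = g
      rw [reindexClass_comp, h₁, reindexClass_id]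
    have hb : ∀ g, Units.map (reindexClass x₀ k δ) (b g) = g := fun g => Units.ext <| by
      show reindexClass x₀ k δ (reindexClass x₀ k φ (g : CohenTarget x₀ n k)) = g
      rw [reindexClass_comp, h₂, reindexClass_id]
    simp only [c, map_iteratedComm, List.map_append, List.map_map, List.map_cons, List.map_nil,
      Function.comp_def, ha, hb]
    simp
  rw [← hc]
  refine Units.ext (PointedClasses.pullback_diagonal_eq_one hx₀ hcat
    (i := p.castSucc) (j := Fin.last n) (Fin.castSucc_lt_last _).ne δ (by simp [δ]) _ ?_ ?_)
  · have : Units.map (updateClass x₀ k p.castSucc) c = 1 := by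
      rw [map_iteratedComm]
      refine iteratedComm_eq_one (List.mem_map.2 ⟨a (u x), by simp, Units.ext ?_⟩)
      show updateClass x₀ k p.castSucc (reindexClass x₀ k Fin.castSucc (u x)) = 1
      rw [hu, reindexClass_wordClass]
      exact updateClass_wordClass ⟨s, congrArg Fin.castSucc hs⟩
    exact congrArg Units.val this
  · have : Units.map (updateClass x₀ k (Fin.last n)) c = 1 := by
      rw [map_iteratedComm]
      refine iteratedComm_eq_one (List.mem_map.2 ⟨b (u y), ?_, Units.ext ?_⟩)
      · exact List.mem_append_right _ (List.mem_map_of_mem (List.mem_map_of_mem hy))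
      show updateClass x₀ k (Fin.last n) (reindexClass x₀ k φ (u y)) = 1
      rw [hu, reindexClass_wordClass]
      exact updateClass_wordClass ⟨t, by simp [φ, ht]⟩
    exact congrArg Units.val this

/-- The homomorphism out of the group `K_n(k)`. -/
theorem exists_cohenGroup_hom (hx₀ : NondegenerateBasePoint x₀) (hcat : WeakLSCatLT x₀ 2) {k : ℕ}
    (hk : 1 ≤ k) (h : ∀ a : CohenTarget x₀ n k, IsUnit a) :
    ∃ e : CohenGroup n k →* CohenTarget x₀ n k,
      ∀ i : Fin k → Fin n, e (PresentedGroup.of i) = wordClass x₀ i := by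
  let u : (Fin k → Fin n) → (CohenTarget x₀ n k)ˣ := fun i => (h (wordClass x₀ i)).unit
  have hu : ∀ i, (u i : CohenTarget x₀ n k) = wordClass x₀ i := fun i => IsUnit.unit_spec _
  have hcomm := iteratedComm_wordClass_eq_one hx₀ hcat u hu
  have hrel : ∀ r ∈ {r : FreeGroup (Fin k → Fin n) | CohenRelator n k r},
      FreeGroup.lift u r = 1 := by
    rintro r (⟨i, hi⟩ | ⟨L, hL⟩ | ⟨L⟩)
    · rw [FreeGroup.lift_apply_of]
      exact Units.ext ((hu i).trans (wordClass_eq_one hx₀ hcat hi))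
    · rw [map_iteratedComm]
      simpa [Function.comp_def] using hcomm L hL
    -- A word listed twice repeats its index at position 0, which exists since k ≥ 1.
    · have h₀ : ∀ l : List (Fin k → Fin n), ¬ l.Nodup → iteratedComm (l.map u) = 1 := by
        refine fun l hl => hcomm l fun hl' => hl ?_
        rw [List.nodup_flatMap] at hl'
        refine hl'.2.imp fun {x y} hxy e => hxy (a := x ⟨0, hk⟩) ?_ ?_
        · exact (List.mem_ofFn' _ _).2 ⟨_, rfl⟩
        · exact (List.mem_ofFn' _ _).2 ⟨⟨0, hk⟩, by rw [e]⟩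
      have := iteratedComm_zpow u h₀ L
      rw [map_mul, map_inv, map_zpow, map_iteratedComm, map_iteratedComm]
      simp only [List.map_map, Function.comp_def, map_zpow, FreeGroup.lift_apply_of]
      rw [this, mul_inv_cancel]
  refine ⟨(Units.coeHom _).comp (PresentedGroup.toGroup hrel), fun i => ?_⟩
  rw [MonoidHom.comp_apply, PresentedGroup.toGroup.of]
  exact hu i

end Relations

end Classes

section

open Metric Set

/-! ### Extension over balls -/

theorem continuousOn_ite_le {Y Z : Type*} [TopologicalSpace Y] [TopologicalSpace Z] {s : Set Y}
    (hs : IsClosed s) {f g : Y → Z} {a b : Y → ℝ} (ha : Continuous a) (hb : Continuous b)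
    (hf : ContinuousOn f (s ∩ {y | a y ≤ b y})) (hg : ContinuousOn g (s ∩ {y | b y ≤ a y}))
    (h : ∀ y ∈ s, a y = b y → f y = g y) :
    ContinuousOn (fun y => if a y ≤ b y then f y else g y) s := by
  have hs' : s = (s ∩ {y | a y ≤ b y}) ∪ (s ∩ {y | b y ≤ a y}) := by
    ext y
    simp only [mem_union, mem_inter_iff, mem_ofPred_eq, ← and_or_left, le_total, and_true]
  rw [hs']
  refine ContinuousOn.union_of_isClosed (hf.congr fun y hy => if_pos hy.2)
    (hg.congr fun y hy => ?_) (hs.inter (isClosed_le ha hb)) (hs.inter (isClosed_le hb ha))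
  by_cases hab : a y ≤ b y
  · simp only [if_pos hab, h y hy.1 (le_antisymm hab hy.2)]
  · simp only [if_neg hab]

section Ball

variable {V : Type*} [NormedAddCommGroup V] {T : Type*} [TopologicalSpace T]

/-- In the maximum norm the unit sphere of V × ℝ is the boundary of a cylinder: side, bottom and
top. Extending a homotopy over a ball thus becomes extending a map over a ball of one dimension
more. -/
theorem mem_sphere_prod_iff {x : V × ℝ} : x ∈ sphere (0 : V × ℝ) 1 ↔
    (x.1 ∈ sphere (0 : V) 1 ∧ x.2 ∈ Icc (-1 : ℝ) 1) ∨
      x.1 ∈ closedBall (0 : V) 1 ∧ (x.2 = -1 ∨ x.2 = 1) := by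
  rw [mem_sphere_zero_iff_norm, mem_sphere_zero_iff_norm, mem_closedBall_zero_iff, Prod.norm_def,
    Real.norm_eq_abs, mem_Icc, ← abs_le]
  have : (x.2 = -1 ∨ x.2 = 1) ↔ |x.2| = 1 := by rw [abs_eq zero_le_one, or_comm]
  rw [this]
  constructor
  · intro h
    rcases max_choice ‖x.1‖ |x.2| with e | e
    · exact Or.inl ⟨e ▸ h, (le_max_right _ _).trans h.le⟩
    · exact Or.inr ⟨(le_max_left _ _).trans h.le, e ▸ h⟩
  · rintro (⟨h, h'⟩ | ⟨h, h'⟩)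
    · rw [h, max_eq_left h']
    · rw [h', max_eq_right h]

theorem closedBall_prod_eq : closedBall (0 : V × ℝ) 1 = closedBall (0 : V) 1 ×ˢ Icc (-1 : ℝ) 1 := by
  have := closedBall_prod_same (0 : V) (0 : ℝ) 1
  rw [Real.closedBall_eq_Icc] at this
  norm_num at this
  exact this.symm

theorem continuousOn_sphere_prod {P : Type*} [TopologicalSpace P] {C : Set P} (hC : IsClosed C)
    {k : (V × ℝ) × P → T} {kS kB kT : (V × ℝ) × P → T}
    (hS : ContinuousOn kS ((sphere 0 1 ×ˢ Icc (-1) 1) ×ˢ C))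
    (hB : ContinuousOn kB ((closedBall 0 1 ×ˢ {-1}) ×ˢ C))
    (hT : ContinuousOn kT ((closedBall 0 1 ×ˢ {1}) ×ˢ C))
    (eS : ∀ x ∈ sphere (0 : V) 1, ∀ t ∈ Icc (-1 : ℝ) 1, ∀ c ∈ C, k ((x, t), c) = kS ((x, t), c))
    (eB : ∀ x ∈ closedBall (0 : V) 1, ∀ c ∈ C, k ((x, -1), c) = kB ((x, -1), c))
    (eT : ∀ x ∈ closedBall (0 : V) 1, ∀ c ∈ C, k ((x, 1), c) = kT ((x, 1), c)) :
    ContinuousOn k (sphere 0 1 ×ˢ C) := by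
  have hu : sphere (0 : V × ℝ) 1 ×ˢ C = ((sphere 0 1 ×ˢ Icc (-1) 1) ×ˢ C) ∪
      (((closedBall 0 1 ×ˢ {-1}) ×ˢ C) ∪ ((closedBall 0 1 ×ˢ {1}) ×ˢ C)) := by
    ext ⟨x, c⟩
    simp only [mem_prod, mem_union, mem_sphere_prod_iff, mem_singleton_iff]
    tauto
  rw [hu]
  refine ContinuousOn.union_of_isClosed (hS.congr ?_)
    (ContinuousOn.union_of_isClosed (hB.congr ?_) (hT.congr ?_) ?_ ?_) ?_ (IsClosed.union ?_ ?_)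
  · rintro ⟨⟨x, t⟩, c⟩ ⟨⟨hx, ht⟩, hc⟩
    exact eS x hx t ht c hc
  · rintro ⟨⟨x, t⟩, c⟩ ⟨⟨hx, rfl⟩, hc⟩
    exact eB x hx c hc
  · rintro ⟨⟨x, t⟩, c⟩ ⟨⟨hx, rfl⟩, hc⟩
    exact eT x hx c hc
  all_goals
    first
    | exact (isClosed_sphere.prod isClosed_Icc).prod hC
    | exact (isClosed_closedBall.prod isClosed_singleton).prod hC

variable [NormedSpace ℝ V]

theorem continuousOn_normalize :
    ContinuousOn (fun x : V => ‖x‖⁻¹ • x) {x | 1 / 2 ≤ ‖x‖} := by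
  refine ContinuousOn.smul (continuous_norm.continuousOn.inv₀ fun x hx => ?_) continuousOn_id
  have : (1 / 2 : ℝ) ≤ ‖x‖ := hx
  linarith

theorem normalize_mem_sphere {x : V} (hx : 1 / 2 ≤ ‖x‖) : ‖x‖⁻¹ • x ∈ sphere (0 : V) 1 := by
  have : ‖x‖ ≠ 0 := by linarith
  rw [mem_sphere_zero_iff_norm, norm_smul, norm_inv, norm_norm, inv_mul_cancel₀ this]

/-- A map on a sphere that is homotopic to a map that extends over the ball extends itself. -/
theorem exists_extension_of_homotopic (ψ Ψ : V → T) (h : V × ℝ → T)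
    (hΨ : ContinuousOn Ψ (closedBall 0 1)) (hh : ContinuousOn h (sphere 0 1 ×ˢ Icc 0 1))
    (h₀ : ∀ x ∈ sphere (0 : V) 1, h (x, 0) = ψ x) (h₁ : ∀ x ∈ sphere (0 : V) 1, h (x, 1) = Ψ x) :
    ∃ Ψ' : V → T, ContinuousOn Ψ' (closedBall 0 1) ∧ ∀ x ∈ sphere (0 : V) 1, Ψ' x = ψ x := by
  -- A half-size copy of `Ψ` sits inside a shell on which the homotopy runs from `ψ` at radius 1 to
  -- `Ψ` at radius 1/2.
  refine ⟨fun x => if ‖x‖ ≤ 1 / 2 then Ψ ((2 : ℝ) • x) else h (‖x‖⁻¹ • x, 2 - 2 * ‖x‖),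
    continuousOn_ite_le isClosed_closedBall continuous_norm continuous_const ?_ ?_ ?_, ?_⟩
  · refine hΨ.comp (by fun_prop) fun x hx => ?_
    have : ‖x‖ ≤ 1 / 2 := hx.2
    rw [mem_closedBall_zero_iff, norm_smul, Real.norm_ofNat]
    linarith
  · refine hh.comp ((continuousOn_normalize.mono inter_subset_right).prodMk (by fun_prop))
      fun x hx => ⟨normalize_mem_sphere hx.2, ?_⟩
    have h₁ : ‖x‖ ≤ 1 := mem_closedBall_zero_iff.1 hx.1
    have h₂ : 1 / 2 ≤ ‖x‖ := hx.2
    constructor <;> dsimp only <;> linarith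
  · intro x _ hx
    have e : ‖x‖⁻¹ • x = (2 : ℝ) • x := by rw [hx]; norm_num
    have e' : 2 - 2 * ‖x‖ = 1 := by rw [hx]; norm_num
    rw [e', h₁ _ (normalize_mem_sphere hx.ge), e]
  · intro x hx
    have hx' : ‖x‖ = 1 := mem_sphere_zero_iff_norm.1 hx
    simp only [hx']
    rw [if_neg (by norm_num)]
    norm_num [h₀ x hx]

end Ball

section Monoid

variable {M : Type u} [TopologicalSpace M] [Monoid M] [ContinuousKMul M]

/-- Products are only known to be continuous on compact Hausdorff test spaces in the universe `u`;
hence the compact set and `ULift`. -/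
theorem continuousOn_kmul {W : Type} [TopologicalSpace W] [T2Space W] {s : Set W}
    (hs : IsCompact s) {f g : W → M} (hf : ContinuousOn f s) (hg : ContinuousOn g s) :
    ContinuousOn (fun w => f w * g w) s := by
  have : CompactSpace s := isCompact_iff_compactSpace.1 hs
  rw [continuousOn_iff_continuous_domRestrict] at *
  have h := ContinuousKMul.continuous_mul_test (ULift.{u} s) (fun x => s.domRestrict f x.down)
    (fun x => s.domRestrict g x.down) (hf.comp continuous_uliftDown) (hg.comp continuous_uliftDown)
  exact h.comp continuous_uliftUp

variable {V : Type} [NormedAddCommGroup V] [NormedSpace ℝ V] [ProperSpace V]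

/-- A right inverse up to homotopy of a map `f` into a monoid on a ball can be prescribed on the
sphere, provided that `f` has a constant two-sided inverse up to homotopy. -/
theorem exists_extension_rightInverse {f : V → M} {b : M} {p q : V × ℝ → M}
    (hf : ContinuousOn f (closedBall 0 1)) (hp : ContinuousOn p (closedBall 0 1 ×ˢ Icc 0 1))
    (hq : ContinuousOn q (closedBall 0 1 ×ˢ Icc 0 1))
    (p₀ : ∀ x ∈ closedBall (0 : V) 1, p (x, 0) = f x * b)
    (p₁ : ∀ x ∈ closedBall (0 : V) 1, p (x, 1) = 1)
    (q₀ : ∀ x ∈ closedBall (0 : V) 1, q (x, 0) = b * f x)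
    (q₁ : ∀ x ∈ closedBall (0 : V) 1, q (x, 1) = 1)
    {g : V → M} {H : V × ℝ → M} (hg : ContinuousOn g (sphere 0 1))
    (hH : ContinuousOn H (sphere 0 1 ×ˢ Icc (-1) 1))
    (H₀ : ∀ x ∈ sphere (0 : V) 1, H (x, -1) = f x * g x)
    (H₁ : ∀ x ∈ sphere (0 : V) 1, H (x, 1) = 1) :
    ∃ (g' : V → M) (Γ : V × ℝ → M), ContinuousOn g' (closedBall 0 1) ∧
      ContinuousOn Γ (closedBall 0 1 ×ˢ Icc (-1) 1) ∧
      (∀ x ∈ closedBall (0 : V) 1, Γ (x, -1) = f x * g' x) ∧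
      (∀ x ∈ closedBall (0 : V) 1, Γ (x, 1) = 1) ∧ (∀ x ∈ sphere (0 : V) 1, g' x = g x) ∧
      ∀ x ∈ sphere (0 : V) 1, ∀ t ∈ Icc (-1 : ℝ) 1, Γ (x, t) = H (x, t) := by
  have cB : IsCompact (closedBall (0 : V) 1) := isCompact_closedBall 0 1
  have cS : IsCompact (sphere (0 : V) 1) := isCompact_sphere 0 1
  have hSB : sphere (0 : V) 1 ⊆ closedBall 0 1 := sphere_subset_closedBall
  -- For fixed s this is a path in t: back along `q · g` from time s to b·f·g, then along `b · H` to
  -- b, stretched over the remaining length 2 - s. At s = 0 it is `b · H`; at s = 1 it leads from g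
  -- to b.
  let K : (V × ℝ) × ℝ → M := fun z => if z.1.2 + 1 ≤ z.2 then q (z.1.1, z.2 - (z.1.2 + 1)) * g z.1.1
    else b * H (z.1.1, -1 + 2 * (z.1.2 + 1 - z.2) / (2 - z.2))
  have cK : IsCompact ((sphere (0 : V) 1 ×ˢ Icc (-1 : ℝ) 1) ×ˢ Icc (0 : ℝ) 1) :=
    (cS.prod isCompact_Icc).prod isCompact_Icc
  have hK : ContinuousOn K ((sphere 0 1 ×ˢ Icc (-1) 1) ×ˢ Icc 0 1) := by
    refine continuousOn_ite_le cK.isClosed (by fun_prop) (by fun_prop) ?_ ?_ ?_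
    · refine continuousOn_kmul (cK.inter_right (isClosed_le (by fun_prop) (by fun_prop))) ?_ ?_
      · refine hq.comp (by fun_prop) ?_
        rintro ⟨⟨x, t⟩, s⟩ ⟨⟨⟨hx, ht⟩, hs⟩, h⟩
        simp only [mem_Icc, mem_ofPred_eq] at ht hs h
        exact ⟨hSB hx, by constructor <;> dsimp only <;> linarith⟩
      · exact hg.comp (by fun_prop) fun z hz => hz.1.1.1
    · refine continuousOn_kmul (cK.inter_right (isClosed_le (by fun_prop) (by fun_prop)))
        continuousOn_const (hH.comp ?_ ?_)
      · refine ContinuousOn.prodMk (by fun_prop) (continuousOn_const.add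
          (ContinuousOn.div (by fun_prop) (by fun_prop) ?_))
        rintro ⟨⟨x, t⟩, s⟩ ⟨⟨⟨hx, ht⟩, hs⟩, h⟩
        simp only [mem_Icc] at hs
        dsimp only
        linarith
      · rintro ⟨⟨x, t⟩, s⟩ ⟨⟨⟨hx, ht⟩, hs⟩, h⟩
        simp only [mem_Icc, mem_ofPred_eq] at ht hs h
        have h2 : 0 < 2 - s := by linarith
        refine ⟨hx, ?_, ?_⟩
        · have : 0 ≤ 2 * (t + 1 - s) / (2 - s) := div_nonneg (by linarith) h2.le
          dsimp only
          linarith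
        · have : 2 * (t + 1 - s) / (2 - s) ≤ 2 := by
            rw [div_le_iff₀ h2]
            linarith
          dsimp only
          linarith
    · rintro ⟨⟨x, t⟩, s⟩ ⟨⟨hx, ht⟩, hs⟩ h
      dsimp only at h hx ⊢
      rw [h]
      simp only [sub_self, mul_zero, zero_div, add_zero]
      rw [q₀ x (hSB hx), H₀ x hx, mul_assoc]
  have K_bot : ∀ x, ∀ s ∈ Icc (0 : ℝ) 1, K ((x, -1), s) = q (x, s) * g x := fun x s hs => by
    simp only [K]
    rw [if_pos (by linarith [hs.1])]
    simp
  have K_top : ∀ x ∈ sphere (0 : V) 1, ∀ s ∈ Icc (0 : ℝ) 1, K ((x, 1), s) = b := fun x hx s hs => by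
    have h2 : 2 - s ≠ 0 := by linarith [hs.2]
    simp only [K]
    rw [if_neg (by linarith [hs.2])]
    have : -1 + 2 * (1 + 1 - s) / (2 - s) = 1 := by field_simp; ring
    rw [this, H₁ x hx, mul_one]
  have K_zero : ∀ x ∈ sphere (0 : V) 1, ∀ t ∈ Icc (-1 : ℝ) 1, K ((x, t), 0) = b * H (x, t) := by
    intro x hx t ht
    simp only [K]
    split_ifs with h
    · have : t = -1 := le_antisymm (by linarith) ht.1
      subst this
      simp only [neg_add_cancel, sub_zero]
      rw [q₀ x (hSB hx), H₀ x hx, mul_assoc]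
    · congr 3
      ring
  -- The path from g to the constant b, `K` at s = 1, is extended over the ball: 3 - 4‖x‖ runs from
  -- -1 at radius 1 to 1 at radius 1/2, where b is reached. The bottom of `Q` is the required
  -- extension of g.
  let Q : V × ℝ → M := fun z => if ‖z.1‖ ≤ 1 / 2 then b else
    K ((‖z.1‖⁻¹ • z.1, max (3 - 4 * ‖z.1‖) z.2), 1)
  have hQ : ContinuousOn Q (closedBall 0 1 ×ˢ Icc (-1) 1) := by
    refine continuousOn_ite_le (isClosed_closedBall.prod isClosed_Icc) (by fun_prop) (by fun_prop)
      continuousOn_const (hK.comp ?_ ?_) ?_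
    · refine ContinuousOn.prodMk (ContinuousOn.prodMk ?_ (by fun_prop)) continuousOn_const
      exact continuousOn_normalize.comp continuousOn_fst fun z hz => hz.2
    · rintro ⟨x, t⟩ ⟨⟨hx, ht⟩, h⟩
      simp only [mem_Icc, mem_ofPred_eq, mem_closedBall_zero_iff] at ht h hx
      refine ⟨⟨normalize_mem_sphere h, le_max_of_le_right ht.1, max_le ?_ ht.2⟩, by simp⟩
      dsimp only
      linarith
    · rintro ⟨x, t⟩ ⟨hx, ht⟩ h
      dsimp only at h ⊢
      have : max (3 - 4 * ‖x‖) t = 1 := by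
        rw [h]
        norm_num
        exact ht.2
      rw [this, K_top _ (normalize_mem_sphere h.ge) 1 (by simp)]
  have Q_sphere : ∀ x ∈ sphere (0 : V) 1, ∀ t ∈ Icc (-1 : ℝ) 1, Q (x, t) = K ((x, t), 1) := by
    intro x hx t ht
    have hx' : ‖x‖ = 1 := mem_sphere_zero_iff_norm.1 hx
    simp only [Q, hx']
    rw [if_neg (by norm_num)]
    norm_num
    rw [max_eq_right ht.1]
  have Q_top : ∀ x ∈ closedBall (0 : V) 1, Q (x, 1) = b := by
    intro x hx
    simp only [Q]
    split_ifs with h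
    · rfl
    · rw [max_eq_right (by linarith), K_top _ (normalize_mem_sphere (by linarith)) 1 (by simp)]
  let g' : V → M := fun x => Q (x, -1)
  have hg' : ContinuousOn g' (closedBall 0 1) :=
    hQ.comp (by fun_prop) fun x hx => ⟨hx, by simp⟩
  have g'_sphere : ∀ x ∈ sphere (0 : V) 1, g' x = g x := fun x hx => by
    simp only [g']
    rw [Q_sphere x hx _ (by simp), K_bot x 1 (by simp), q₁ x (hSB hx), one_mul]
  -- The values prescribed for Γ on the boundary of the cylinder. First b·ψ is shown to extend, then
  -- f·b·ψ, and finally ψ.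
  let ψ : V × ℝ → M := fun z => if ‖z.1‖ = 1 then H z else if z.2 < 0 then f z.1 * g' z.1 else 1
  have ψS : ∀ x ∈ sphere (0 : V) 1, ∀ t ∈ Icc (-1 : ℝ) 1, ψ (x, t) = H (x, t) := fun x hx t _ =>
    if_pos (mem_sphere_zero_iff_norm.1 hx)
  have ψB : ∀ x ∈ closedBall (0 : V) 1, ψ (x, -1) = f x * g' x := fun x hx => by
    by_cases h : ‖x‖ = 1
    · have hx := mem_sphere_zero_iff_norm.2 h
      rw [ψS x hx _ (by simp), H₀ x hx, g'_sphere x hx]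
    · simp [ψ, h]
  have ψT : ∀ x ∈ closedBall (0 : V) 1, ψ (x, 1) = 1 := fun x hx => by
    by_cases h : ‖x‖ = 1
    · have hx := mem_sphere_zero_iff_norm.2 h
      rw [ψS x hx _ (by simp), H₁ x hx]
    · simp [ψ, h]
  have hψ : ContinuousOn (fun z : (V × ℝ) × ℝ => ψ z.1) (sphere 0 1 ×ˢ Icc 0 1) := by
    refine continuousOn_sphere_prod isClosed_Icc (kS := fun z => H z.1)
      (kB := fun z => f z.1.1 * g' z.1.1) (kT := fun _ => 1) (hH.comp continuousOn_fst fun z hz => hz.1)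
      ?_ continuousOn_const (fun x hx t ht _ _ => ψS x hx t ht) (fun x hx _ _ => ψB x hx)
      (fun x hx _ _ => ψT x hx)
    exact continuousOn_kmul ((cB.prod isCompact_singleton).prod isCompact_Icc)
      (hf.comp (by fun_prop) fun z hz => hz.1.1) (hg'.comp (by fun_prop) fun z hz => hz.1.1)
  -- A homotopy from b·ψ to the boundary values of `Q`, which do extend.
  let k : (V × ℝ) × ℝ → M := fun z => if ‖z.1.1‖ = 1 then K z else
    if z.1.2 < 0 then q (z.1.1, z.2) * g' z.1.1 else b
  have kS : ∀ x ∈ sphere (0 : V) 1, ∀ t ∈ Icc (-1 : ℝ) 1, ∀ s ∈ Icc (0 : ℝ) 1,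
      k ((x, t), s) = K ((x, t), s) := fun x hx t _ s _ => if_pos (mem_sphere_zero_iff_norm.1 hx)
  have kB : ∀ x ∈ closedBall (0 : V) 1, ∀ s ∈ Icc (0 : ℝ) 1,
      k ((x, -1), s) = q (x, s) * g' x := fun x hx s hs => by
    by_cases h : ‖x‖ = 1
    · have hx := mem_sphere_zero_iff_norm.2 h
      rw [kS x hx _ (by simp) s hs, K_bot x s hs, g'_sphere x hx]
    · simp [k, h]
  have kT : ∀ x ∈ closedBall (0 : V) 1, ∀ s ∈ Icc (0 : ℝ) 1, k ((x, 1), s) = b := fun x hx s hs => by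
    by_cases h : ‖x‖ = 1
    · have hx := mem_sphere_zero_iff_norm.2 h
      rw [kS x hx _ (by simp) s hs, K_top x hx s hs]
    · simp [k, h]
  have hk : ContinuousOn k (sphere 0 1 ×ˢ Icc 0 1) := by
    refine continuousOn_sphere_prod isClosed_Icc (kS := K)
      (kB := fun z => q (z.1.1, z.2) * g' z.1.1) (kT := fun _ => b) hK ?_ continuousOn_const kS kB kT
    exact continuousOn_kmul ((cB.prod isCompact_singleton).prod isCompact_Icc)
      (hq.comp (by fun_prop) fun z hz => ⟨hz.1.1, hz.2⟩)
      (hg'.comp (by fun_prop) fun z hz => hz.1.1)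
  have cB' : IsCompact (closedBall (0 : V × ℝ) 1) := isCompact_closedBall 0 1
  obtain ⟨δ, hδ, δψ⟩ := exists_extension_of_homotopic (fun z => b * ψ z) Q k
    (by rw [closedBall_prod_eq]; exact hQ) hk
    (by
      rintro ⟨x, t⟩ hx
      rcases mem_sphere_prod_iff.1 hx with ⟨hx, ht⟩ | ⟨hx, rfl | rfl⟩
      · rw [kS x hx t ht 0 (by simp), K_zero x hx t ht, ψS x hx t ht]
      · rw [kB x hx 0 (by simp), ψB x hx, q₀ x hx, mul_assoc]
      · rw [kT x hx 0 (by simp), ψT x hx, mul_one])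
    (by
      rintro ⟨x, t⟩ hx
      rcases mem_sphere_prod_iff.1 hx with ⟨hx, ht⟩ | ⟨hx, rfl | rfl⟩
      · rw [kS x hx t ht 1 (by simp), Q_sphere x hx t ht]
      · rw [kB x hx 1 (by simp), q₁ x hx, one_mul]
      · rw [kT x hx 1 (by simp), Q_top x hx])
  have hfst : ∀ z ∈ closedBall (0 : V × ℝ) 1, z.1 ∈ closedBall (0 : V) 1 := fun z hz => by
    rw [closedBall_prod_eq] at hz
    exact hz.1
  have hsph : sphere (0 : V × ℝ) 1 ⊆ closedBall 0 1 := sphere_subset_closedBall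
  -- `f · δ` extends f·b·ψ, and `p` with time reversed joins ψ to f·b·ψ.
  obtain ⟨Γ, hΓ, Γψ⟩ := exists_extension_of_homotopic ψ (fun z => f z.1 * δ z)
    (fun z => p (z.1.1, 1 - z.2) * ψ z.1)
    (continuousOn_kmul cB' (hf.comp continuousOn_fst hfst) hδ)
    (continuousOn_kmul ((isCompact_sphere _ _).prod isCompact_Icc) (hp.comp (by fun_prop) (by
      rintro ⟨z, s⟩ ⟨hz, hs⟩
      refine ⟨hfst z (hsph hz), ?_⟩
      simp only [mem_Icc] at hs ⊢
      constructor <;> linarith)) hψ)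
    (fun z hz => by
      dsimp only
      rw [sub_zero, p₁ _ (hfst z (hsph hz)), one_mul])
    (fun z hz => by
      dsimp only
      rw [sub_self, p₀ _ (hfst z (hsph hz)), δψ z hz, mul_assoc])
  refine ⟨g', Γ, hg', ?_, fun x hx => ?_, fun x hx => ?_, g'_sphere, fun x hx t ht => ?_⟩
  · rwa [closedBall_prod_eq] at hΓ
  · rw [Γψ _ (mem_sphere_prod_iff.2 (Or.inr ⟨hx, Or.inl rfl⟩)), ψB x hx]
  · rw [Γψ _ (mem_sphere_prod_iff.2 (Or.inr ⟨hx, Or.inr rfl⟩)), ψT x hx]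
  · rw [Γψ _ (mem_sphere_prod_iff.2 (Or.inl ⟨hx, ht⟩)), ψS x hx t ht]

end Monoid

end

section

open Metric Set

/-! ### Right inverses on CW complexes -/

section Monoid

variable {M : Type u} [TopologicalSpace M] [Monoid M] [ContinuousKMul M]

theorem joined_mul {a b c d : M} (h : Joined a b) (h' : Joined c d) : Joined (a * c) (b * d) := by
  obtain ⟨p⟩ := h
  obtain ⟨q⟩ := h'
  refine ⟨⟨⟨fun t => p t * q t, ?_⟩, by simp, by simp⟩⟩
  rw [← continuousOn_univ]
  exact continuousOn_kmul isCompact_univ p.continuous.continuousOn q.continuous.continuousOn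

/-- In a monoid whose path components form a group, inverses up to paths are two-sided. -/
theorem exists_joined_mul_one (hM : ∀ m : M, ∃ m', Joined (m * m') 1) (m : M) :
    ∃ b, Joined (m * b) 1 ∧ Joined (b * m) 1 := by
  obtain ⟨b, hb⟩ := hM m
  obtain ⟨c, hc⟩ := hM b
  refine ⟨b, hb, ?_⟩
  have h₁ : Joined (b * m * (b * c)) (b * m * 1) := joined_mul (Joined.refl _) hc
  have h₂ : Joined (b * ((m * b) * c)) (b * (1 * c)) :=
    joined_mul (Joined.refl _) (joined_mul hb (Joined.refl _))
  rw [mul_one] at h₁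
  rw [one_mul] at h₂
  have e : b * m * (b * c) = b * ((m * b) * c) := by simp only [mul_assoc]
  rw [e] at h₁
  exact h₁.symm.trans (h₂.trans hc)

variable {V : Type} [NormedAddCommGroup V] [NormedSpace ℝ V]

/-- The ball is shrunk to its centre, then the path is followed. -/
theorem exists_homotopy_of_joined {T : Type*} [TopologicalSpace T] {F : V → T} {t₀ : T}
    (hF : ContinuousOn F (closedBall 0 1)) (h : Joined (F 0) t₀) :
    ∃ p : V × ℝ → T, ContinuousOn p (closedBall 0 1 ×ˢ Icc 0 1) ∧
      (∀ x ∈ closedBall (0 : V) 1, p (x, 0) = F x) ∧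
      ∀ x ∈ closedBall (0 : V) 1, p (x, 1) = t₀ := by
  obtain ⟨γ⟩ := h
  refine ⟨fun z => if z.2 ≤ 1 / 2 then F ((1 - 2 * z.2) • z.1) else γ (clamp (2 * z.2 - 1)),
    continuousOn_ite_le (isClosed_closedBall.prod isClosed_Icc) (by fun_prop) (by fun_prop)
      (hF.comp (by fun_prop) ?_) ?_ ?_, fun x hx => ?_, fun x hx => ?_⟩
  · rintro ⟨x, t⟩ ⟨⟨hx, ht⟩, h⟩
    simp only [mem_Icc, mem_ofPred_eq, mem_closedBall_zero_iff] at hx ht h ⊢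
    rw [norm_smul, Real.norm_eq_abs, abs_of_nonneg (by linarith)]
    exact mul_le_one₀ (by linarith) (norm_nonneg x) hx
  · exact (γ.continuous.comp (continuous_clamp.comp (by fun_prop))).continuousOn
  · rintro ⟨x, t⟩ - h
    dsimp only at h ⊢
    rw [clamp_of_le_zero (by linarith), γ.source, h]
    norm_num
  · simp
  · dsimp only
    rw [if_neg (by norm_num), clamp_of_one_le (by norm_num), γ.target]

/-- Over a ball a constant inverse of `f 0` up to paths is an inverse of all of `f` up to homotopy.
-/
theorem exists_extension_of_joined [ProperSpace V] (hM : ∀ m : M, ∃ m', Joined (m * m') 1)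
    {f : V → M} (hf : ContinuousOn f (closedBall 0 1)) {g : V → M} {H : V × ℝ → M}
    (hg : ContinuousOn g (sphere 0 1)) (hH : ContinuousOn H (sphere 0 1 ×ˢ Icc (-1) 1))
    (H₀ : ∀ x ∈ sphere (0 : V) 1, H (x, -1) = f x * g x)
    (H₁ : ∀ x ∈ sphere (0 : V) 1, H (x, 1) = 1) :
    ∃ (g' : V → M) (Γ : V × ℝ → M), ContinuousOn g' (closedBall 0 1) ∧
      ContinuousOn Γ (closedBall 0 1 ×ˢ Icc (-1) 1) ∧
      (∀ x ∈ closedBall (0 : V) 1, Γ (x, -1) = f x * g' x) ∧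
      (∀ x ∈ closedBall (0 : V) 1, Γ (x, 1) = 1) ∧ (∀ x ∈ sphere (0 : V) 1, g' x = g x) ∧
      ∀ x ∈ sphere (0 : V) 1, ∀ t ∈ Icc (-1 : ℝ) 1, Γ (x, t) = H (x, t) := by
  obtain ⟨b, hb, hb'⟩ := exists_joined_mul_one hM (f 0)
  have cB : IsCompact (closedBall (0 : V) 1) := isCompact_closedBall 0 1
  obtain ⟨p, hp, p₀, p₁⟩ := exists_homotopy_of_joined (F := fun x => f x * b)
    (continuousOn_kmul cB hf continuousOn_const) hb
  obtain ⟨q, hq, q₀, q₁⟩ := exists_homotopy_of_joined (F := fun x => b * f x)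
    (continuousOn_kmul cB continuousOn_const hf) hb'
  exact exists_extension_rightInverse hf hp hq p₀ p₁ q₀ q₁ hg hH H₀ H₁

end Monoid

/-- Continuity on the image of a compact set can be tested after composition. -/
theorem continuousOn_image_of_comp {Y Z T : Type*} [TopologicalSpace Y] [TopologicalSpace Z]
    [T2Space Z] [TopologicalSpace T] {s : Set Y} (hs : IsCompact s) {φ : Y → Z}
    (hφ : ContinuousOn φ s) {F : Z → T} (hF : ContinuousOn (F ∘ φ) s) :
    ContinuousOn F (φ '' s) := by
  rw [continuousOn_iff_isClosed]
  intro C hC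
  obtain ⟨D, hD, hDs⟩ := (continuousOn_iff_isClosed.1 hF) C hC
  refine ⟨φ '' (D ∩ s), ((hs.inter_left hD).image_of_continuousOn
    (hφ.mono inter_subset_right)).isClosed, ?_⟩
  rw [← hDs]
  ext z
  constructor
  · rintro ⟨hz, y, hy, rfl⟩
    exact ⟨⟨y, ⟨hz, hy⟩, rfl⟩, y, hy, rfl⟩
  · rintro ⟨⟨y, ⟨hy, hys⟩, rfl⟩, hz⟩
    exact ⟨hy, hz⟩

/-! ### Induction over the cells. -/

section CW

open CWComplex

variable {K : Type u} [TopologicalSpace K] [CWComplex (Set.univ : Set K)]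

theorem exists_mem_closedCell (x : K) :
    ∃ (n : ℕ) (e : cell (Set.univ : Set K) n), x ∈ closedCell n e := by
  have : x ∈ ⋃ (n : ℕ) (e : cell (Set.univ : Set K) n), closedCell n e := by
    rw [CWComplex.union]
    trivial
  simpa using this

/-- Closure finiteness: with finitely many closed cells, continuity on each gives continuity on
their union. -/
theorem exists_mapsTo_sphere {m : ℕ} (e : cell (Set.univ : Set K) m) :
    ∃ J : Set (Σ n, cell (Set.univ : Set K) n), J.Finite ∧ (∀ j ∈ J, j.1 < m) ∧
      MapsTo (map m e) (sphere 0 1) (⋃ j : J, closedCell j.1.1 j.1.2) := by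
  classical
  obtain ⟨J, hJ⟩ := CWComplex.mapsTo m e
  refine ⟨((Finset.range m).sigma J : Finset (Σ n, cell (Set.univ : Set K) n)),
    Finset.finite_toSet _, fun j hj => ?_, fun y hy => ?_⟩
  · simp only [Finset.mem_coe, Finset.mem_sigma, Finset.mem_range] at hj
    exact hj.1
  · have := hJ hy
    simp only [mem_iUnion, exists_prop] at this
    obtain ⟨n, hn, j, hj, hy'⟩ := this
    exact mem_iUnion.2 ⟨⟨⟨n, j⟩, by simp [hn, hj]⟩, hy'⟩

variable [T2Space K]

/-- A map on a CW complex that is continuous on all closed cells is continuous. -/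
theorem continuous_of_closedCell {T : Type*} [TopologicalSpace T] {F : K → T}
    (hF : ∀ n (e : cell (Set.univ : Set K) n), ContinuousOn F (closedCell n e)) :
    Continuous F := by
  refine continuous_iff_isClosed.2 fun C hC => ?_
  rw [CWComplex.closed Set.univ _ (subset_univ _)]
  intro n e
  rw [inter_comm]
  exact (hF n e).preimage_isClosed_of_isClosed RelCWComplex.isClosed_closedCell hC

theorem notMem_openCell {n m : ℕ} (h : n < m) {e : cell (Set.univ : Set K) n} {x : K}
    (hx : x ∈ closedCell n e) (e' : cell (Set.univ : Set K) m) : x ∉ openCell m e' := by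
  have h₁ := RelCWComplex.closedCell_subset_skeletonLT n e hx
  have h₂ := RelCWComplex.skeletonLT_mono (C := (Set.univ : Set K)) (m := (n : ℕ∞) + 1) (n := m)
    (by exact_mod_cast h)
  exact disjoint_left.1 (RelCWComplex.disjoint_skeletonLT_openCell le_rfl) (h₂ h₁)

variable {M : Type u} [TopologicalSpace M] [Monoid M] [ContinuousKMul M]

/-- `g` is a right inverse of `f` on the cells of dimension less than `m`, up to the homotopy
`Γ`. -/
def IsPartialInverse (f : K → M) (m : ℕ) (g : K → M) (Γ : K × ℝ → M) : Prop :=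
  ∀ n < m, ∀ e : cell (Set.univ : Set K) n, ContinuousOn g (closedCell n e) ∧
    ContinuousOn Γ (closedCell n e ×ˢ Icc (-1) 1) ∧
      ∀ x ∈ closedCell n e, Γ (x, -1) = f x * g x ∧ Γ (x, 1) = 1

/-- Pulled back along a characteristic map, the task on an m-cell is `exists_extension_of_joined`.
Old values on lower cells are kept so that the stages have a limit. -/
theorem IsPartialInverse.exists_succ (hM : ∀ m : M, ∃ m', Joined (m * m') 1) {f : K → M}
    (hf : Continuous f) {m : ℕ} {g : K → M} {Γ : K × ℝ → M} (h : IsPartialInverse f m g Γ) :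
    ∃ g' Γ', IsPartialInverse f (m + 1) g' Γ' ∧ ∀ n < m, ∀ e : cell (Set.univ : Set K) n,
      ∀ x ∈ closedCell n e, g' x = g x ∧ ∀ t, Γ' (x, t) = Γ (x, t) := by
  classical
  have hext : ∀ e : cell (Set.univ : Set K) m, ∃ (g' : (Fin m → ℝ) → M)
      (Γ' : (Fin m → ℝ) × ℝ → M), ContinuousOn g' (closedBall 0 1) ∧
      ContinuousOn Γ' (closedBall 0 1 ×ˢ Icc (-1) 1) ∧
      (∀ x ∈ closedBall (0 : Fin m → ℝ) 1, Γ' (x, -1) = f (map m e x) * g' x) ∧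
      (∀ x ∈ closedBall (0 : Fin m → ℝ) 1, Γ' (x, 1) = 1) ∧
      (∀ x ∈ sphere (0 : Fin m → ℝ) 1, g' x = g (map m e x)) ∧
      ∀ x ∈ sphere (0 : Fin m → ℝ) 1, ∀ t ∈ Icc (-1 : ℝ) 1, Γ' (x, t) = Γ (map m e x, t) := by
    intro e
    obtain ⟨J, hJ, hJm, hmaps⟩ := exists_mapsTo_sphere e
    have := hJ.to_subtype
    have hφ := RelCWComplex.continuousOn m e
    have hφ' := hφ.mono sphere_subset_closedBall
    have hg : ContinuousOn g (⋃ j : J, closedCell j.1.1 j.1.2) :=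
      (locallyFinite_of_finite _).continuousOn_iUnion (fun j => RelCWComplex.isClosed_closedCell)
        fun j => (h _ (hJm _ j.2) _).1
    have hΓ : ContinuousOn Γ (⋃ j : J, closedCell j.1.1 j.1.2 ×ˢ Icc (-1 : ℝ) 1) :=
      (locallyFinite_of_finite _).continuousOn_iUnion
        (fun j => RelCWComplex.isClosed_closedCell.prod isClosed_Icc)
        fun j => (h _ (hJm _ j.2) _).2.1
    have hpt : ∀ x ∈ sphere (0 : Fin m → ℝ) 1,
        Γ (map m e x, -1) = f (map m e x) * g (map m e x) ∧ Γ (map m e x, 1) = 1 := by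
      intro x hx
      obtain ⟨j, hj⟩ := mem_iUnion.1 (hmaps hx)
      exact (h _ (hJm _ j.2) _).2.2 _ hj
    refine exists_extension_of_joined hM (f := fun x => f (map m e x))
      (g := fun x => g (map m e x)) (H := fun z => Γ (map m e z.1, z.2))
      (hf.comp_continuousOn hφ) (hg.comp hφ' hmaps) (hΓ.comp ?_ ?_) (fun x hx => (hpt x hx).1)
      fun x hx => (hpt x hx).2
    · exact (hφ'.comp continuousOn_fst fun z hz => hz.1).prodMk continuousOn_snd
    · rintro ⟨x, t⟩ ⟨hx, ht⟩
      obtain ⟨j, hj⟩ := mem_iUnion.1 (hmaps hx)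
      exact mem_iUnion.2 ⟨j, hj, ht⟩
  choose ge Γe hge hΓe Γe₀ Γe₁ ge_sphere Γe_sphere using hext
  -- Open m-cells are disjoint from each other and from the lower closed cells, so only they receive
  -- new values; `hcell` shows that these fit on the attaching spheres too.
  let g' : K → M := fun x => if hx : ∃ e : cell (Set.univ : Set K) m, x ∈ openCell m e then
    ge hx.choose ((map m hx.choose).symm x) else g x
  let Γ' : K × ℝ → M := fun z => if hx : ∃ e : cell (Set.univ : Set K) m, z.1 ∈ openCell m e then
    Γe hx.choose ((map m hx.choose).symm z.1, z.2) else Γ z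
  have hlow : ∀ n < m, ∀ e : cell (Set.univ : Set K) n, ∀ x ∈ closedCell n e,
      g' x = g x ∧ ∀ t, Γ' (x, t) = Γ (x, t) := by
    intro n hn e x hx
    have : ¬ ∃ e : cell (Set.univ : Set K) m, x ∈ openCell m e :=
      fun ⟨e', he'⟩ => notMem_openCell hn hx e' he'
    exact ⟨dif_neg this, fun t => dif_neg this⟩
  have hcell : ∀ e : cell (Set.univ : Set K) m, ∀ y ∈ closedBall (0 : Fin m → ℝ) 1,
      g' (map m e y) = ge e y ∧ ∀ t ∈ Icc (-1 : ℝ) 1, Γ' (map m e y, t) = Γe e (y, t) := by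
    intro e y hy
    rcases (mem_closedBall.1 hy).lt_or_eq with hy' | hy'
    · have hy' : y ∈ ball (0 : Fin m → ℝ) 1 := hy'
      have hx : ∃ e : cell (Set.univ : Set K) m, map m e y ∈ openCell m e :=
        ⟨e, mem_image_of_mem _ hy'⟩
      have hx' : ∃ e' : cell (Set.univ : Set K) m, map m e y ∈ openCell m e' :=
        ⟨e, mem_image_of_mem _ hy'⟩
      have hch : hx'.choose = e := by
        by_contra hne
        refine disjoint_left.1 (RelCWComplex.disjoint_openCell_of_ne
          (C := (Set.univ : Set K)) (i := hx'.choose) (j := e) ?_) hx'.choose_spec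
          (mem_image_of_mem _ hy')
        simpa using hne
      have hsymm : (map m e).symm (map m e y) = y :=
        (map m e).left_inv (by rw [RelCWComplex.source_eq]; exact hy')
      constructor
      · simp only [g', dif_pos hx']
        rw [hch, hsymm]
      · intro t _
        simp only [Γ', dif_pos hx']
        rw [hch, hsymm]
    · have hy' : y ∈ sphere (0 : Fin m → ℝ) 1 := hy'
      obtain ⟨J, hJ, hJm, hmaps⟩ := exists_mapsTo_sphere e
      obtain ⟨j, hj⟩ := mem_iUnion.1 (hmaps hy')
      have := hlow _ (hJm _ j.2) _ _ hj
      refine ⟨by rw [this.1, ge_sphere e y hy'], fun t ht => ?_⟩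
      rw [this.2, Γe_sphere e y hy' t ht]
  refine ⟨g', Γ', fun n hn e => ?_, hlow⟩
  rcases (Nat.lt_succ_iff.1 hn).lt_or_eq with hn | rfl
  · obtain ⟨h₁, h₂, h₃⟩ := h n hn e
    have := hlow n hn e
    refine ⟨h₁.congr fun x hx => (this x hx).1, h₂.congr fun z hz => (this z.1 hz.1).2 z.2,
      fun x hx => ?_⟩
    rw [(this x hx).1, (this x hx).2, (this x hx).2]
    exact h₃ x hx
  · have hφ := RelCWComplex.continuousOn n e
    refine ⟨?_, ?_, ?_⟩
    · refine continuousOn_image_of_comp (isCompact_closedBall _ _) hφ ?_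
      exact (hge e).congr fun y hy => (hcell e y hy).1
    · have : closedCell n e ×ˢ Icc (-1 : ℝ) 1 =
          Prod.map (map n e) id '' (closedBall 0 1 ×ˢ Icc (-1 : ℝ) 1) := by
        rw [prodMap_image_prod, image_id]; rfl
      rw [this]
      refine continuousOn_image_of_comp ((isCompact_closedBall _ _).prod isCompact_Icc)
        (hφ.prodMap continuousOn_id) ?_
      exact (hΓe e).congr fun z hz => (hcell e z.1 hz.1).2 z.2 hz.2
    · rintro _ ⟨y, hy, rfl⟩
      rw [(hcell e y hy).1, (hcell e y hy).2 _ (by simp), (hcell e y hy).2 _ (by simp)]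
      exact ⟨Γe₀ e y hy, Γe₁ e y hy⟩

/-- Maps from a CW complex into a monoid whose path components form a group have right inverses
up to homotopy. -/
theorem exists_rightInverse_of_cwComplex (hM : ∀ m : M, ∃ m', Joined (m * m') 1) (f : C(K, M)) :
    ∃ (g : C(K, M)) (F : C(I × K, M)), (∀ x, F (0, x) = f x * g x) ∧ ∀ x, F (1, x) = 1 := by
  have h₀ : IsPartialInverse f 0 (fun _ => 1) (fun _ => 1) := fun n hn => absurd hn (by simp)
  choose! G Γ hG using fun (m : ℕ) (s : (K → M) × (K × ℝ → M)) (h : IsPartialInverse f m s.1 s.2) =>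
    h.exists_succ hM f.continuous
  let s : ℕ → (K → M) × (K × ℝ → M) := fun m =>
    Nat.rec (fun _ => 1, fun _ => 1) (fun m s => (G m s, Γ m s)) m
  have hs : ∀ m, IsPartialInverse f m (s m).1 (s m).2 := by
    intro m
    induction m with
    | zero => exact h₀
    | succ m ih => exact (hG m (s m) ih).1
  have hagree : ∀ n, ∀ e : cell (Set.univ : Set K) n, ∀ x ∈ closedCell n e, ∀ m, n < m →
      (s m).1 x = (s (n + 1)).1 x ∧ ∀ t, (s m).2 (x, t) = (s (n + 1)).2 (x, t) := by
    intro n e x hx m hm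
    induction m, hm using Nat.le_induction with
    | base => exact ⟨rfl, fun _ => rfl⟩
    | succ m hm ih =>
      have := (hG m (s m) (hs m)).2 n hm e x hx
      exact ⟨this.1.trans ih.1, fun t => (this.2 t).trans (ih.2 t)⟩
  -- Any cell containing the point will do, since the stages agree beyond its dimension.
  choose N E hE using exists_mem_closedCell (K := K)
  let g : K → M := fun x => (s (N x + 1)).1 x
  let Δ : K × ℝ → M := fun z => (s (N z.1 + 1)).2 z
  have key : ∀ n, ∀ e : cell (Set.univ : Set K) n, ∀ x ∈ closedCell n e,
      g x = (s (n + 1)).1 x ∧ ∀ t, Δ (x, t) = (s (n + 1)).2 (x, t) := by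
    intro n e x hx
    have h₁ := hagree n e x hx (n + N x + 1) (by omega)
    have h₂ := hagree (N x) (E x) x (hE x) (n + N x + 1) (by omega)
    exact ⟨h₂.1.symm.trans h₁.1, fun t => (h₂.2 t).symm.trans (h₁.2 t)⟩
  have hg : Continuous g := continuous_of_closedCell fun n e =>
    (hs (n + 1) n (Nat.lt_succ_self n) e).1.congr fun x hx => (key n e x hx).1
  have hΔ : ∀ n, ∀ e : cell (Set.univ : Set K) n,
      ContinuousOn Δ (closedCell n e ×ˢ Icc (-1) 1) := fun n e =>
    (hs (n + 1) n (Nat.lt_succ_self n) e).2.1.congr fun z hz => (key n e z.1 hz.1).2 z.2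
  have hmem : ∀ t : I, 2 * (t : ℝ) - 1 ∈ Icc (-1 : ℝ) 1 := fun t =>
    ⟨by linarith [t.2.1], by linarith [t.2.2]⟩
  have hx : ∀ x, Continuous fun t : I => Δ (x, 2 * (t : ℝ) - 1) := fun x =>
    (hΔ _ _).comp_continuous (by fun_prop) fun t => ⟨hE x, hmem t⟩
  -- Currying reduces continuity to the cells of `K`, without a cell structure on the product with
  -- the interval.
  let Φ : K → C(I, M) := fun x => ⟨fun t => Δ (x, 2 * (t : ℝ) - 1), hx x⟩
  have hΦ : Continuous Φ := by
    refine continuous_of_closedCell fun n e => ?_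
    rw [continuousOn_iff_continuous_domRestrict]
    refine ContinuousMap.continuous_of_continuous_uncurry _ ?_
    exact (hΔ n e).comp_continuous (f := fun p : closedCell n e × I => ((p.1 : K), 2 * (p.2 : ℝ) - 1))
      (by fun_prop) fun p => ⟨p.1.2, hmem p.2⟩
  refine ⟨⟨g, hg⟩, ⟨fun p => Φ p.2 p.1, ?_⟩, fun x => ?_, fun x => ?_⟩
  · exact (ContinuousMap.continuous_uncurry_of_continuous ⟨Φ, hΦ⟩).comp continuous_swap
  · have h₁ := (hs (N x + 1) _ (Nat.lt_succ_self _) (E x)).2.2 x (hE x)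
    simpa [Φ, Δ, g] using h₁.1
  · have h₁ := (hs (N x + 1) _ (Nat.lt_succ_self _) (E x)).2.2 x (hE x)
    have e : 2 * ((1 : I) : ℝ) - 1 = 1 := by norm_num
    simpa only [Φ, Δ, ContinuousMap.coe_mk, e] using h₁.2

end CW

end

/-! ### Mapping monoids and right inverses on powers -/

theorem locallyCompactSpace_of_compact (K : Type*) [TopologicalSpace K] [CompactSpace K]
    [T2Space K] : LocallyCompactSpace K := inferInstance

instance locallyCompactSpace_compHaus (L : CompHaus.{u}) : LocallyCompactSpace L :=
  locallyCompactSpace_of_compact L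

/-- The set of continuous maps from `Z` to `M`, with the topology that turns continuous families
parametrized by a locally compact space into maps on the product. -/
def MapK (Z M : Type u) [TopologicalSpace Z] [TopologicalSpace M] : Type u := C(Z, M)

section MapK

variable {Z M : Type u} [TopologicalSpace Z] [TopologicalSpace M]

instance : TopologicalSpace (MapK Z M) :=
  ⨅ (L : CompHaus.{u}) (a : C(L, Z)),
    TopologicalSpace.induced (fun f : C(Z, M) => (f.comp a : C(L, M))) inferInstance

instance : CoeFun (MapK Z M) fun _ => Z → M := ⟨fun f z => ContinuousMap.toFun f z⟩

/-- The exponential law for the compact-open topology, applied to each locally compact test space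
`L`. -/
theorem MapK.continuous_iff {Y : Type*} [TopologicalSpace Y] {φ : Y → MapK Z M} :
    Continuous φ ↔ ∀ (L : CompHaus.{u}) (a : C(L, Z)),
      Continuous fun p : Y × L => φ p.1 (a p.2) := by
  rw [continuous_iInf_rng]
  refine forall_congr' fun L => ?_
  rw [continuous_iInf_rng]
  refine forall_congr' fun a => ?_
  rw [continuous_induced_rng]
  exact ⟨fun h => ContinuousMap.continuous_uncurry_of_continuous ⟨_, h⟩,
    fun h => ContinuousMap.continuous_of_continuous_uncurry _ h⟩

variable [IsGeneratedBy compHausFamily.{u} Z] [Monoid M] [ContinuousKMul M]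

instance : Monoid (MapK Z M) where
  mul f g := ⟨fun z => f z * g z, continuous_kmul (ContinuousMap.continuous f)
    (ContinuousMap.continuous g)⟩
  one := ContinuousMap.const Z 1
  mul_assoc f g h := ContinuousMap.ext fun z => mul_assoc (f z) (g z) (h z)
  one_mul f := ContinuousMap.ext fun z => one_mul (f z)
  mul_one f := ContinuousMap.ext fun z => mul_one (f z)

theorem MapK.mul_apply (f g : MapK Z M) (z : Z) : (f * g) z = f z * g z := rfl

theorem MapK.one_apply (z : Z) : (1 : MapK Z M) z = 1 := rfl

/-- This makes mapping monoids admissible targets in `HasRightInverses`. -/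
instance : ContinuousKMul (MapK Z M) where
  continuous_mul_test K _ _ _ f g hf hg := by
    rw [MapK.continuous_iff] at *
    intro L a
    exact ContinuousKMul.continuous_mul_test (K × L) _ _ (hf L a) (hg L a)

end MapK

/-- Maps from `W` to monoids whose path components form a group have right inverses up to
homotopy. -/
def HasRightInverses (W : Type u) [TopologicalSpace W] : Prop :=
  ∀ (M : Type u) [TopologicalSpace M] [Monoid M] [ContinuousKMul M],
    (∀ m : M, ∃ m', Joined (m * m') 1) → ∀ f : C(W, M), ∃ (g : C(W, M)) (F : C(I × W, M)),
      (∀ w, F (0, w) = f w * g w) ∧ ∀ w, F (1, w) = 1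

variable {X : Type u} [TopologicalSpace X]

/-- A right inverse is found on the complex and pulled back along the equivalence; the homotopy from
`f` to its round trip corrects the product. -/
theorem hasRightInverses_of_hasCWHomotopyType [CompactlyGeneratedSpace X]
    (h : HasCWHomotopyType X) : HasRightInverses X := by
  obtain ⟨K, _, _, ⟨_⟩, ⟨e⟩⟩ := h
  intro M _ _ _ hM f
  obtain ⟨g, F, F₀, F₁⟩ := exists_rightInverse_of_cwComplex hM (f.comp e.invFun)
  obtain ⟨A⟩ : f.Homotopic (f.comp (e.invFun.comp e.toFun)) :=
    ContinuousMap.Homotopic.comp (.refl f) e.left_inv.symm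
  let p₀ : C(X, M) := ⟨fun x => f x * g (e x), continuous_kmul (by fun_prop) (by fun_prop)⟩
  let p₁ : C(X, M) := ⟨fun x => f (e.invFun (e x)) * g (e x),
    continuous_kmul (by fun_prop) (by fun_prop)⟩
  have B : p₀.Homotopy p₁ := {
    toFun p := A p * g (e p.2)
    continuous_toFun := continuous_kmul_homotopy (by fun_prop) (by fun_prop)
    map_zero_left x := by simp [p₀]
    map_one_left x := by simp [p₁] }
  have C : p₁.Homotopy (.const X 1) := {
    toFun p := F (p.1, e p.2)
    map_zero_left x := F₀ _
    map_one_left x := F₁ _ }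
  exact ⟨g.comp e.toFun, (B.trans C).toContinuousMap, (B.trans C).apply_zero,
    (B.trans C).apply_one⟩

/-- The tail of a point of a power. -/
def KPow.tail {n : ℕ} (v : KPow X (n + 1)) : KPow X n := KPow.mk (Fin.tail v.coord)

theorem KPow.continuous_tail {n : ℕ} : Continuous (KPow.tail : KPow X (n + 1) → KPow X n) :=
  KPow.continuous_mk (continuous_pi fun i => KPow.continuous_coord_apply i.succ)

/-- The adjoint of a map on a power of `X`. -/
def curryKPow [CompactlyGeneratedSpace X] {M : Type u} [TopologicalSpace M] {n : ℕ}
    (f : C(KPow X (n + 1), M)) : C(X, MapK (KPow X n) M) where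
  toFun x := (⟨fun v => f (KPow.mk (Fin.cons x v.coord)), f.continuous.comp (KPow.continuous_mk
    (continuous_const.finCons KPow.continuous_coord))⟩ : C(KPow X n, M))
  continuous_toFun := by
    refine MapK.continuous_iff.2 fun L a => ?_
    refine continuous_prod_of_test (fun p : X × L => f (KPow.mk (Fin.cons p.1 (a p.2).coord)))
      fun L' b => ?_
    refine f.continuous.comp (KPow.continuous_mk (W := L' × L) ?_)
    exact (b.continuous.comp continuous_fst).finCons
      (KPow.continuous_coord.comp (a.continuous.comp continuous_snd))

theorem continuous_uncurryKPow {M : Type u} [TopologicalSpace M] {n : ℕ}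
    {ψ : I × X → MapK (KPow X n) M} (hψ : Continuous ψ) :
    Continuous fun p : I × KPow X (n + 1) => ψ (p.1, p.2.coord 0) p.2.tail := by
  have h : Continuous fun p : KPow X (n + 1) × I => ψ (p.2, p.1.coord 0) p.1.tail := by
    refine continuous_prod_of_test _ fun L a => ?_
    have h₁ := MapK.continuous_iff.1 hψ L ⟨fun l => (a l).tail,
      KPow.continuous_tail.comp a.continuous⟩
    have h₀ : Continuous fun l : L => (a l).coord 0 :=
      (KPow.continuous_coord_apply 0).comp a.continuous
    have h₂ : Continuous fun p : L × I => ((p.2, (a p.1).coord 0), p.1) :=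
      (continuous_snd.prodMk (h₀.comp continuous_fst)).prodMk continuous_fst
    exact h₁.comp h₂
  have hs : Continuous fun p : I × KPow X (n + 1) => (p.2, p.1) := continuous_swap
  have key := h.comp hs
  exact key

/-- A homotopy is a path in the mapping monoid, whose path components therefore again satisfy the
hypothesis on targets. -/
theorem HasRightInverses.exists_joined {W : Type u} [TopologicalSpace W]
    [IsGeneratedBy compHausFamily.{u} W] (h : HasRightInverses W) {M : Type u} [TopologicalSpace M]
    [Monoid M] [ContinuousKMul M] (hM : ∀ m : M, ∃ m', Joined (m * m') 1) (f : MapK W M) :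
    ∃ g, Joined (f * g) 1 := by
  obtain ⟨g, F, F₀, F₁⟩ := h M hM f
  let γ : I → MapK W M := fun t => (⟨fun w => F (t, w), by fun_prop⟩ : C(W, M))
  have hγ : Continuous γ := MapK.continuous_iff.2 fun L a =>
    F.continuous.comp (continuous_fst.prodMk (a.continuous.comp continuous_snd))
  exact ⟨g, ⟨⟨⟨γ, hγ⟩, ContinuousMap.ext F₀, ContinuousMap.ext F₁⟩⟩⟩

/-- A map from the power n + 1 to M is a map from X to the mapping monoid of the n-th power, a valid
target by induction. No cell structure on powers is needed. -/
theorem HasRightInverses.kPow [CompactlyGeneratedSpace X] (h : HasRightInverses X) (n : ℕ) :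
    HasRightInverses (KPow X n) := by
  induction n with
  | zero =>
    intro M _ _ _ hM f
    let v₀ : KPow X 0 := KPow.mk Fin.elim0
    have hv : ∀ v : KPow X 0, v = v₀ := fun v =>
      congrArg KPow.mk (Subsingleton.elim v.coord v₀.coord)
    obtain ⟨m, ⟨γ⟩⟩ := hM (f v₀)
    refine ⟨.const _ m, ⟨fun p => γ p.1, by fun_prop⟩, fun v => ?_, fun v => γ.target⟩
    rw [hv v]
    exact γ.source
  | succ n ih =>
    intro M _ _ _ hM f
    obtain ⟨ψ, F, F₀, F₁⟩ := h (MapK (KPow X n) M) (fun m => ih.exists_joined hM m) (curryKPow f)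
    have hF := continuous_uncurryKPow F.continuous
    have hψ := (continuous_uncurryKPow (ψ := fun p : I × X => ψ p.2) (by fun_prop)).comp
      (Continuous.prodMk_right (0 : I))
    refine ⟨⟨fun v => ψ (v.coord 0) v.tail, hψ⟩, ⟨_, hF⟩, fun v => ?_, fun v => ?_⟩
    · show F (0, v.coord 0) v.tail = _
      rw [F₀, MapK.mul_apply]
      congr 1
      show f (KPow.mk (Fin.cons (v.coord 0) (Fin.tail v.coord))) = f v
      rw [Fin.cons_self_tail, KPow.mk_coord]
    · show F (1, v.coord 0) v.tail = 1
      rw [F₁, MapK.one_apply]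

/-! ### Path connectedness of the James construction -/

theorem joined_smash_base [PathConnectedSpace X] (x₀ : X) {k : ℕ} (y : Smash x₀ k) :
    Joined y (Smash.base x₀ k) := by
  obtain ⟨v⟩ := y
  let γ := fun i => (PathConnectedSpace.joined (v.coord i) x₀).somePath
  have : IsGeneratedBy compHausFamily.{u} (ULift.{u} I) := isGeneratedBy_of_compactlyGenerated _
  have h : Continuous fun t : ULift.{u} I => Smash.mk x₀ fun i => γ i t.down :=
    Smash.continuous_mk x₀ (continuous_pi fun i => (γ i).continuous.comp continuous_uliftDown)
  refine ⟨⟨⟨fun t => Smash.mk x₀ fun i => γ i t, h.comp continuous_uliftUp⟩, ?_, ?_⟩⟩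
  · simp only [Path.source]; rfl
  · simp only [Path.target]; rfl

theorem James.joined_one {Y : Type u} [TopologicalSpace Y] [IsGeneratedBy compHausFamily.{u} Y]
    {y₀ : Y} (hY : ∀ y, Joined y y₀) (m : James y₀) : Joined m 1 := by
  obtain ⟨l, rfl⟩ : ∃ l, James.word y₀ l = m := by
    obtain ⟨l⟩ := m
    exact ⟨l.toList, rfl⟩
  induction l with
  | nil => exact Joined.refl _
  | cons y l ih =>
    have h : Joined (James.word y₀ [y]) 1 := by
      obtain ⟨γ⟩ := hY y
      rw [← James.word_base y₀]
      exact ⟨γ.map (James.incl y₀).continuous⟩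
    have := joined_mul h ih
    rw [← James.word_append, mul_one] at this
    exact this

/-! ### Invertibility of the homotopy classes -/

/-- At the base point f is 1, so the homotopy from f·g to 1 restricts to a path from g to 1.
Non-degeneracy then deforms g to a pointed map and makes the null homotopy of the product pointed.
-/
theorem exists_mul_eq_one {x₀ : X} (hx₀ : NondegenerateBasePoint x₀) {n : ℕ}
    (hn : HasRightInverses (KPow X n)) {M : Type u} [TopologicalSpace M] [Monoid M]
    [ContinuousKMul M] (hM : ∀ m : M, Joined m 1)
    (a : PointedClasses (KPow.mk fun _ : Fin n => x₀) M) : ∃ b, a * b = 1 := by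
  obtain ⟨f⟩ := a
  obtain ⟨g, F, F₀, F₁⟩ := hn M (fun m => ⟨1, by rw [mul_one]; exact hM m⟩) f.1
  obtain ⟨D, hD⟩ := exists_nbhdRetract_base hx₀ n
  let A : (g.comp D.r).Homotopy (.const _ 1) := {
    toFun p := F (p.1, D.r p.2)
    map_zero_left w := by
      show F (0, D.r w) = _
      rw [F₀, hD, f.2, one_mul, ContinuousMap.comp_apply, hD]
    map_one_left w := F₁ _ }
  obtain ⟨g', ⟨G⟩, hg', -⟩ := D.exists_eq_on_range g A
  let g'' : PointedMap (KPow.mk fun _ : Fin n => x₀) M := ⟨g', by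
    have := hg' (KPow.mk fun _ => x₀)
    rwa [hD] at this⟩
  refine ⟨PointedClasses.mk g'', PointedClasses.eq_one_of_homotopic (f := f * g'') hx₀ ?_⟩
  let p : C(KPow X n, M) := ⟨fun v => f.1 v * g v, continuous_kmul (by fun_prop) (by fun_prop)⟩
  have B : (f * g'').1.Homotopy p := {
    toFun q := f.1 q.2 * G.symm q
    continuous_toFun := continuous_kmul_homotopy (by fun_prop) (by fun_prop)
    map_zero_left v := by
      rw [G.symm.apply_zero]; rfl
    map_one_left v := by
      rw [G.symm.apply_one]; rfl }
  have C : p.Homotopy (.const _ 1) := {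
    toFun := F
    map_zero_left := F₀
    map_one_left := F₁ }
  exact ⟨B.trans C⟩

theorem isUnit_of_forall_exists_mul_eq_one {A : Type*} [Monoid A] (h : ∀ a : A, ∃ b, a * b = 1)
    (a : A) : IsUnit a := by
  obtain ⟨b, hab⟩ := h a
  obtain ⟨c, hbc⟩ := h b
  have hac : a = c := by rw [← mul_one a, ← hbc, ← mul_assoc, hab, one_mul]
  exact ⟨⟨a, b, hab, by rw [hac, hbc]⟩, rfl⟩

theorem isUnit_cohenTarget [CompactlyGeneratedSpace X] [PathConnectedSpace X] {x₀ : X}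
    (hx₀ : NondegenerateBasePoint x₀) (h : HasCWHomotopyType X) {n k : ℕ}
    (a : CohenTarget x₀ n k) : IsUnit a :=
  isUnit_of_forall_exists_mul_eq_one (exists_mul_eq_one hx₀
    ((hasRightInverses_of_hasCWHomotopyType h).kPow n)
    (James.joined_one (joined_smash_base x₀))) a

end CohenJames

theorem proposition2p5 {X : Type u} [TopologicalSpace X] [CompactlyGeneratedSpace X]
    [PathConnectedSpace X] (x₀ : X) (hx₀ : CohenJames.NondegenerateBasePoint x₀) (hcat : CohenJames.WeakLSCatLT x₀ 2)
    (n k : ℕ) (hk : 1 ≤ k) :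
    (CohenJames.HasCWHomotopyType X → ∀ a : CohenJames.CohenTarget x₀ n k, IsUnit a) ∧
      ((∀ a : CohenJames.CohenTarget x₀ n k, IsUnit a) →
        ∃ e : CohenJames.CohenGroup n k →* CohenJames.CohenTarget x₀ n k,
          ∀ i : Fin k → Fin n, e (PresentedGroup.of i) = CohenJames.wordClass x₀ i) := by
  exact ⟨fun h a => CohenJames.isUnit_cohenTarget hx₀ h a,
    fun h => CohenJames.exists_cohenGroup_hom hx₀ hcat hk h⟩
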